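/- Consider testing $\mathcal H_0$ against $\mathcal H_1$ with $K\ge 1$ sensors, $\pi_1=\mathbb P(\mathcal H_1)\in[0,1]$, $\pi_0=1-\pi_1$. Under $\mathcal H_i$ the samples of sensor $\ell$ are i.i.d. with density $f_i^\ell$ and are independent across sensors. A procedure consists of a sensor $\delta_{t+1}\in\{1,\dots,K\}$ for each $t\ge 0$, which is a measurable function of the samples $X_1,\dots,X_t$ observed so far, a stopping time $\mathsf T\in\{0,1,2,\dots\}\cup\{\infty\}$ of the observed samples, and a decision $D_{\mathsf T}\in\{0,1\}$ based on $X_1,\dots,X_{\mathsf T}$. For $\mu_0,\mu_1\ge 0$, a set $\Omega$ of sensors and $\lambda_\ell\ge 0$ $(\ell\in\Omega)$, its Bayes risk is $$\mathcal R=\mathbb E\,\mathsf T+\mu_0\pi_0\mathbb P_0(D_{\mathsf T}=1)+\mu_1\pi_1\mathbb P_1(D_{\mathsf T}=0)+\sum_{\ell\in\Omega}\lambda_\ell\,\mathbb E\Big(\sum_{t=1}^{\mathsf T}\mathbf 1_{\{\delta_t=\ell\}}\Big),$$ where $\mathbb P_i$ is the probability given $\mathcal H_i$ and $\mathbb E=\pi_0\mathbb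 E_0+\pi_1\mathbb E_1$. Let $\widetilde{\mathcal V}(\pi_1)$ be the infimum of $\mathcal R$ over all procedures, $\mathcal V_0^N(\pi_1)$ the infimum over procedures with $\mathsf T\le N$, and $L_t=\sum_{s=1}^t l_{\delta_s}(X_s)$, with $l_\ell=\log(f_1^\ell/f_0^\ell)$, the cumulative log-likelihood ratio (possibly $\pm\infty$ where a density vanishes). Put $\mathcal C_\ell=1+\lambda_\ell$ for $\ell\in\Omega$ and $\mathcal C_\ell=1$ otherwise, $\phi(x)=\min\{\mu_1x,\mu_0(1-x)\}$, and, for a function $V$ on $[0,1]$, $$\mathcal E_V(x,\ell)=\mathcal C_\ell+\mathbb E_x\,V\Big(\frac{x e^{l_\ell(X)}}{1-x+x e^{l_\ell(X)}}\Big),\qquad X\sim(1-x)f_0^\ell+xf_1^\ell .$$ For every $\pi_1\in[0,1]$ the minimum of $\mathcal R$ over all procedures is attained by an SPRT with stationary sensor selection. That is, there are real constants $-A\le B$ and a measurable function $\psi$ such that a procedure with the following three properties minimizes $\mathcal R$: 1. $\delta^\star_{t+1}=\psi(L_t)$ for all $t\ge 0$; 2. $\mathsf T^\star=\min\{t\ge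 0: L_t\notin(-A,B)\}$; 3. $D^\star$ decides $\mathcal H_0$ if $L_{\mathsf T^\star}\le -A$ and $\mathcal H_1$ if $L_{\mathsf T^\star}\ge B$. These $A,B,\psi$ are obtained from $\widetilde{\mathcal V}$: writing $x_L=\pi_1e^L/(\pi_0+\pi_1e^L)$ for $L\in\mathbb R$, one has $L\in(-A,B)$ if and only if $\min_\ell\mathcal E_{\widetilde{\mathcal V}}(x_L,\ell)<\phi(x_L)$, and $\psi(L)$ minimizes $\ell\mapsto\mathcal E_{\widetilde{\mathcal V}}(x_L,\ell)$. Moreover $\lim_{N\to\infty}\mathcal V_0^N(x)=\widetilde{\mathcal V}(x)$ for all $x\in[0,1]$; the function $\widetilde{\mathcal V}$ is concave on $[0,1]$ and satisfies the Bellman equation $$V(x)=\min\Big\{\phi(x),\ \min_{\ell}\mathcal E_V(x,\ell)\Big\},\qquad x\in[0,1],$$ and it is the only bounded measurable function on $[0,1]$ that does so. -/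

import Mathlib

open MeasureTheory Set Filter Topology
open scoped ENNReal NNReal

/-- The data of the Bayes sequential testing problem with `K` sensors whose samples take values
in `X`.  The index `i : Fin 2` is the hypothesis `H_i`. -/
structure SensorTestProblem (K : ℕ) (X : Type*) [MeasurableSpace X] where
  /-- the reference measure of the densities (Lebesgue measure for real samples) -/
  ref : Measure X
  sigmaFinite_ref : SigmaFinite ref
  /-- `density i ℓ` is the density of a sample of sensor `ℓ` under `H_i` -/
  density : Fin 2 → Fin K → X → ℝ≥0
  measurable_density : ∀ i ℓ, Measurable (density i ℓ)
  lintegral_density : ∀ i ℓ, ∫⁻ y, (density i ℓ y : ℝ≥0∞) ∂ref = 1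
  /-- the weight of a wrong decision under `H_0` -/
  μ₀ : ℝ≥0
  /-- the weight of a wrong decision under `H_1` -/
  μ₁ : ℝ≥0
  /-- the sensors whose usage is penalized -/
  constrained : Finset (Fin K)
  /-- the usage multipliers; only the values on `constrained` matter -/
  lam : Fin K → ℝ≥0

/-- A sequential procedure: sensor selection, stopping and decision, each based on the samples
taken so far.  Stopping before any sample is taken, and never stopping, are both allowed. -/
structure SequentialProcedure (K : ℕ) (X : Type*) [MeasurableSpace X] where
  /-- `select n h` is the sensor that takes sample number `n + 1` after the samples `h` -/
  select : (n : ℕ) → (Fin n → X) → Fin K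
  measurable_select : ∀ n, Measurable (select n)
  /-- the histories of length `n` after which the procedure stops, if it has not stopped before -/
  stopSet : (n : ℕ) → Set (Fin n → X)
  measurableSet_stopSet : ∀ n, MeasurableSet (stopSet n)
  /-- the index of the accepted hypothesis if the procedure stops with the samples `h` -/
  decide : (n : ℕ) → (Fin n → X) → Fin 2
  measurable_decide : ∀ n, Measurable (decide n)

namespace SensorTestProblem

variable {K : ℕ} {X : Type*} [MeasurableSpace X] (M : SensorTestProblem K X)

/-- The law of one sample of sensor `ℓ` under `H_i`. -/
noncomputable def sampleLaw (i : Fin 2) (ℓ : Fin K) : Measure X :=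
  M.ref.withDensity fun y => (M.density i ℓ y : ℝ≥0∞)

instance isProbabilityMeasure_sampleLaw (i : Fin 2) (ℓ : Fin K) :
    IsProbabilityMeasure (M.sampleLaw i ℓ) :=
  ⟨by simpa [sampleLaw] using M.lintegral_density i ℓ⟩

/-- The law under `H_i` of the array `ω`, where `ω t ℓ` is the sample that sensor `ℓ` delivers
if it is selected for sample number `t + 1`: independent over time and across sensors. -/
noncomputable def arrayLaw (i : Fin 2) : Measure (ℕ → Fin K → X) :=
  Measure.infinitePi fun _ : ℕ => Measure.pi fun ℓ : Fin K => M.sampleLaw i ℓ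

/-- The log-likelihood ratio `log (f₁ / f₀)` of a sample `y` of sensor `ℓ`, as an extended real:
it is `⊤` where only `f₀` vanishes and `⊥` where `f₁` vanishes. -/
noncomputable def llr (ℓ : Fin K) (y : X) : EReal :=
  ENNReal.log ((M.density 1 ℓ y : ℝ≥0∞) / (M.density 0 ℓ y : ℝ≥0∞))

end SensorTestProblem

namespace SequentialProcedure

variable {K : ℕ} {X : Type*} [MeasurableSpace X] (p : SequentialProcedure K X)

/-- The first `n` observed samples. -/
def history (ω : ℕ → Fin K → X) : (n : ℕ) → (Fin n → X)
  | 0 => Fin.elim0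
  | n + 1 => Fin.snoc (history ω n) (ω n (p.select n (history ω n)))

/-- The sensor selected for sample number `t + 1`. -/
def sensor (ω : ℕ → Fin K → X) (t : ℕ) : Fin K := p.select t (p.history ω t)

/-- Sample number `t + 1` as observed at the fusion center. -/
def sample (ω : ℕ → Fin K → X) (t : ℕ) : X := ω t (p.sensor ω t)

/-- The sample size, `⊤` if the procedure never stops. -/
noncomputable def stopTime (ω : ℕ → Fin K → X) : ℕ∞ :=
  ⨅ (n : ℕ) (_ : p.history ω n ∈ p.stopSet n), (n : ℕ∞)

/-- The event that the procedure stops and accepts the hypothesis `j`. -/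
def acceptEvent (j : Fin 2) : Set (ℕ → Fin K → X) :=
  {ω | ∃ n : ℕ, p.stopTime ω = n ∧ p.decide n (p.history ω n) = j}

open Classical in
/-- The number of samples taken from sensor `ℓ`. -/
noncomputable def usage (ℓ : Fin K) (ω : ℕ → Fin K → X) : ℝ≥0∞ :=
  ∑' t : ℕ, if (t : ℕ∞) < p.stopTime ω ∧ p.sensor ω t = ℓ then 1 else 0

/-- The cumulative log-likelihood ratio `L_n` of the first `n` observed samples. -/
noncomputable def cumLLR (M : SensorTestProblem K X) (ω : ℕ → Fin K → X) (n : ℕ) : EReal :=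
  ∑ t ∈ Finset.range n, M.llr (p.sensor ω t) (p.sample ω t)

/-- `p` is a sequential probability ratio test with the constant thresholds `-A` and `B` and the
stationary sensor selection function `ψ`. -/
structure IsStationarySPRT (M : SensorTestProblem K X) (A B : ℝ) (ψ : EReal → Fin K) : Prop where
  /-- `δ_{t+1} = ψ (L_t)` -/
  sensor_eq : ∀ ω t, p.sensor ω t = ψ (p.cumLLR M ω t)
  /-- `T = min {t : L_t ∉ (-A, B)}` -/
  stopTime_eq : ∀ ω, p.stopTime ω =
    ⨅ (n : ℕ) (_ : p.cumLLR M ω n ∉ Ioo ((-A : ℝ) : EReal) (B : EReal)), (n : ℕ∞)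
  /-- `H_0` is accepted if `L_T ≤ -A` -/
  decide_zero : ∀ ω (n : ℕ), p.stopTime ω = n → p.cumLLR M ω n ≤ ((-A : ℝ) : EReal) →
    p.decide n (p.history ω n) = 0
  /-- `H_1` is accepted if `L_T ≥ B` -/
  decide_one : ∀ ω (n : ℕ), p.stopTime ω = n → (B : EReal) ≤ p.cumLLR M ω n →
    p.decide n (p.history ω n) = 1

end SequentialProcedure

namespace SensorTestProblem

variable {K : ℕ} {X : Type*} [MeasurableSpace X] (M : SensorTestProblem K X)

/-- The expectation of `g` when the prior probability of `H_1` is `x`. -/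
noncomputable def expect (x : ℝ) (g : (ℕ → Fin K → X) → ℝ≥0∞) : ℝ≥0∞ :=
  ENNReal.ofReal (1 - x) * ∫⁻ ω, g ω ∂(M.arrayLaw 0) + ENNReal.ofReal x * ∫⁻ ω, g ω ∂(M.arrayLaw 1)

/-- The Bayes risk of the procedure `p` when the prior probability of `H_1` is `x`: expected
sample size, weighted error probabilities, and weighted expected sensor usages. -/
noncomputable def risk (x : ℝ) (p : SequentialProcedure K X) : ℝ≥0∞ :=
  M.expect x (fun ω => (p.stopTime ω : ℝ≥0∞))
    + M.μ₀ * ENNReal.ofReal (1 - x) * M.arrayLaw 0 (p.acceptEvent 1)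
    + M.μ₁ * ENNReal.ofReal x * M.arrayLaw 1 (p.acceptEvent 0)
    + ∑ ℓ ∈ M.constrained, M.lam ℓ * M.expect x (p.usage ℓ)

/-- `p` minimizes the Bayes risk among all procedures, without a bound on the sample size. -/
def IsOptimal (x : ℝ) (p : SequentialProcedure K X) : Prop :=
  ∀ q : SequentialProcedure K X, M.risk x p ≤ M.risk x q

/-- The optimal cost of the infinite-horizon problem. -/
noncomputable def optCost (x : ℝ) : ℝ :=
  (⨅ p : SequentialProcedure K X, M.risk x p).toReal

/-- The optimal cost of the problem with horizon `N`: at most `N` samples on every realization. -/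
noncomputable def finiteOptCost (N : ℕ) (x : ℝ) : ℝ :=
  (⨅ (p : SequentialProcedure K X) (_ : ∀ ω, p.stopTime ω ≤ (N : ℕ∞)), M.risk x p).toReal

/-- The cost of one sample of sensor `ℓ`. -/
noncomputable def sampleCost (ℓ : Fin K) : ℝ :=
  1 + if ℓ ∈ M.constrained then (M.lam ℓ : ℝ) else 0

/-- The cost of stopping when the posterior probability of `H_1` is `x`. -/
noncomputable def stopCost (x : ℝ) : ℝ := min (M.μ₁ * x) (M.μ₀ * (1 - x))

/-- The posterior probability of `H_1` after a sample `y` of sensor `ℓ`, if it was `x` before.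
It equals `x e^l / (1 - x + x e^l)` for `l = log (f₁ / f₀)` when both densities are positive. -/
noncomputable def update (ℓ : Fin K) (x : ℝ) (y : X) : ℝ :=
  x * M.density 1 ℓ y / ((1 - x) * M.density 0 ℓ y + x * M.density 1 ℓ y)

/-- The cost of one more sample from sensor `ℓ` at the posterior `x` when `V` is the cost-to-go. -/
noncomputable def sensorCost (V : ℝ → ℝ) (x : ℝ) (ℓ : Fin K) : ℝ :=
  M.sampleCost ℓ + ((1 - x) * ∫ y, V (M.update ℓ x y) ∂(M.sampleLaw 0 ℓ)
    + x * ∫ y, V (M.update ℓ x y) ∂(M.sampleLaw 1 ℓ))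

/-- The cost of continuing with the best sensor. -/
noncomputable def continueCost (V : ℝ → ℝ) (x : ℝ) : ℝ := ⨅ ℓ : Fin K, M.sensorCost V x ℓ

/-- The Bellman equation on `[0, 1]`. -/
def SolvesBellman (V : ℝ → ℝ) : Prop :=
  ∀ x ∈ Icc (0 : ℝ) 1, V x = min (M.stopCost x) (M.continueCost V x)

end SensorTestProblem

/-- The posterior probability of `H_1` when its prior probability is `x` and the cumulative
log-likelihood ratio is `L`. -/
noncomputable def posteriorOfLLR (x L : ℝ) : ℝ := x * Real.exp L / (1 - x + x * Real.exp L)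

/-! Fix the prior `x` and mix the two array laws into `bayesLaw x`. Since the next row of samples is
independent of the history, Bayes' rule turns the posterior probability of `H_1` into a controlled
Markov process on [0, 1] (`lintegral_history_succ`, `mix_update_mul`,
`ofReal_mul_lintegral_history`). The error probabilities become expected decision losses at the
posterior, and the risk is a series of nonnegative stage costs (`risk_eq_tsum`): an optimal stopping
and control problem with a one-dimensional state.

Verification solves this problem. Iterating the one-step identity, a bounded subsolution of the
Bellman equation lies below the risk of every procedure (`le_risk`); the remainder vanishes because
finite risk forces a finite expected sample size. A procedure that attains the minimum in the
equation does not exceed the solution (`risk_le`). Value iteration from `φ` decreases, and its limit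
is a fixed point by monotone convergence (`valueLimit_eq_bellman`). Hence the optimal cost is that
limit and every bounded measurable solution agrees with it on [0, 1]; possible negative values are
excluded by `SolvesBellman.nonneg`. Truncating an optimal procedure gives the finite-horizon limit,
and concavity holds because the risk of a fixed procedure is affine in the prior (`risk_combo`).

For the thresholds, the continuation cost `C` is concave as well, being built from perspectives of a
concave function (`perspective_update`), and it is at least 1. The stopping cost `φ` is the minimum
of two lines, one vanishing at 0 and the other at 1. If `C` is below the first line somewhere, it
stays below that line further right, because `C 0 > 0`; the second line is symmetric. So `C < φ`
describes an interval of posteriors. In the coordinate `L` it is open, since concave functions are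
continuous in the interior, and bounded, since `φ < 1` near both ends (`continueSet_eq_Ioo`). As `L`
determines the posterior, the threshold test carries out the optimal policy. An empty interval calls
for stopping at once, with `-A = B` chosen to force the better decision. -/

namespace SequentialProcedure

/-! ### Histories and the stopping time -/

variable {K : ℕ} {X : Type*} [MeasurableSpace X] (p : SequentialProcedure K X)

theorem measurable_snoc {α : Type*} [MeasurableSpace α] {n : ℕ} {f : α → Fin n → X} {g : α → X}
    (hf : Measurable f) (hg : Measurable g) :
    Measurable fun a => (Fin.snoc (f a) (g a) : Fin (n + 1) → X) := by
  refine measurable_pi_iff.2 fun i => ?_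
  refine Fin.lastCases ?_ (fun j => ?_) i
  · simpa using hg
  · simp only [Fin.snoc_castSucc]
    exact (measurable_pi_apply j).comp hf

theorem measurable_init {n : ℕ} : Measurable fun h : Fin (n + 1) → X => (Fin.init h : Fin n → X) :=
  measurable_pi_iff.2 fun i => measurable_pi_apply (Fin.castSucc i)

/-- The observed history as a function of the first `n` rows of the array of samples. -/
def historyOfRows : (n : ℕ) → (Fin n → Fin K → X) → Fin n → X
  | 0, _ => Fin.elim0
  | n + 1, r => Fin.snoc (historyOfRows n (Fin.init r))
      (r (Fin.last n) (p.select n (historyOfRows n (Fin.init r))))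

theorem measurable_eval_select {α : Type*} [MeasurableSpace α] {r : α → Fin K → X}
    {s : α → Fin K} (hr : Measurable r) (hs : Measurable s) : Measurable fun a => r a (s a) := by
  have h : Measurable fun q : (Fin K → X) × Fin K => q.1 q.2 :=
    measurable_from_prod_countable_left fun ℓ => measurable_pi_apply ℓ
  exact h.comp (hr.prodMk hs)

theorem measurable_historyOfRows (n : ℕ) : Measurable (p.historyOfRows n) := by
  induction n with
  | zero => exact measurable_const
  | succ n ih =>
    have h := ih.comp (measurable_init (X := Fin K → X))
    exact measurable_snoc h
      (measurable_eval_select (measurable_pi_apply _) ((p.measurable_select n).comp h))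

theorem history_eq_historyOfRows (ω : ℕ → Fin K → X) (n : ℕ) :
    p.history ω n = p.historyOfRows n fun i => ω i := by
  induction n with
  | zero => rfl
  | succ n ih =>
    rw [history, historyOfRows, ih]
    rfl

theorem measurable_history (n : ℕ) : Measurable fun ω => p.history ω n := by
  simp_rw [history_eq_historyOfRows]
  exact (p.measurable_historyOfRows n).comp (by fun_prop)

@[simp]
theorem init_history (ω : ℕ → Fin K → X) (n : ℕ) :
    (Fin.init (p.history ω (n + 1)) : Fin n → X) = p.history ω n := by
  rw [history, Fin.init_snoc]

/-- The histories of length `n` along which the procedure has not stopped before sample `n`. -/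
def alive : (n : ℕ) → Set (Fin n → X)
  | 0 => univ
  | n + 1 => {h | Fin.init h ∈ alive n ∧ Fin.init h ∉ p.stopSet n}

theorem measurableSet_alive (n : ℕ) : MeasurableSet (p.alive n) := by
  induction n with
  | zero => exact MeasurableSet.univ
  | succ n ih =>
    exact (measurable_init ih).inter (measurable_init (p.measurableSet_stopSet n)).compl

theorem history_succ_mem_alive {ω : ℕ → Fin K → X} {n : ℕ} :
    p.history ω (n + 1) ∈ p.alive (n + 1) ↔
      p.history ω n ∈ p.alive n ∧ p.history ω n ∉ p.stopSet n := by
  change (Fin.init (p.history ω (n + 1)) ∈ _ ∧ Fin.init (p.history ω (n + 1)) ∉ _) ↔ _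
  rw [init_history]

theorem history_mem_alive_iff {ω : ℕ → Fin K → X} {n : ℕ} :
    p.history ω n ∈ p.alive n ↔ ∀ k < n, p.history ω k ∉ p.stopSet k := by
  induction n with
  | zero => simp [alive]
  | succ n ih => rw [history_succ_mem_alive, ih, Nat.forall_lt_succ_right]

theorem le_stopTime_iff {ω : ℕ → Fin K → X} {n : ℕ} :
    (n : ℕ∞) ≤ p.stopTime ω ↔ p.history ω n ∈ p.alive n := by
  simp only [stopTime, le_iInf_iff, Nat.cast_le, history_mem_alive_iff]
  exact ⟨fun h k hk hs => absurd (h k hs) (by omega), fun h k hs => by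
    by_contra hlt
    exact h k (by omega) hs⟩

theorem lt_stopTime_iff {ω : ℕ → Fin K → X} {n : ℕ} :
    (n : ℕ∞) < p.stopTime ω ↔ p.history ω n ∈ p.alive n ∧ p.history ω n ∉ p.stopSet n := by
  rw [← history_succ_mem_alive, ← le_stopTime_iff, Nat.cast_add, Nat.cast_one,
    ENat.add_one_le_iff (ENat.natCast_ne_top n)]

theorem stopTime_eq_coe_iff {ω : ℕ → Fin K → X} {n : ℕ} :
    p.stopTime ω = n ↔ p.history ω n ∈ p.alive n ∧ p.history ω n ∈ p.stopSet n := by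
  have h1 := p.le_stopTime_iff (ω := ω) (n := n)
  have h2 := p.lt_stopTime_iff (ω := ω) (n := n)
  constructor
  · intro h
    have h3 := h1.1 h.ge
    exact ⟨h3, by_contra fun h4 => absurd (h2.2 ⟨h3, h4⟩) (by simp [h])⟩
  · intro h
    refine le_antisymm (not_lt.1 fun h3 => (h2.1 h3).2 h.2) (h1.2 h.1)

/-- The sum counts the `n` with `n < T`: being alive at length `n + 1` means not having stopped at
any time up to `n`. -/
theorem stopTime_toENNReal (ω : ℕ → Fin K → X) :
    (p.stopTime ω : ℝ≥0∞) = ∑' n : ℕ, (p.alive (n + 1)).indicator 1 (p.history ω (n + 1)) := by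
  have h : ∀ n : ℕ, (p.alive (n + 1)).indicator (1 : (Fin (n + 1) → X) → ℝ≥0∞)
      (p.history ω (n + 1)) = {k : ℕ | (k : ℕ∞) < p.stopTime ω}.indicator 1 n := by
    intro n
    simp only [indicator, history_succ_mem_alive, ← lt_stopTime_iff, mem_ofPred_eq, Pi.one_apply]
  simp_rw [h]
  induction p.stopTime ω using ENat.recTopCoe with
  | top => simp
  | coe N =>
    rw [tsum_eq_sum (s := Finset.range N) (fun b hb => by simpa using hb)]
    rw [Finset.sum_congr rfl (g := fun _ => (1 : ℝ≥0∞))]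
    · simp
    · intro k hk
      have hk' := Finset.mem_range.1 hk
      simp [hk']

end SequentialProcedure

/-! ### Independence of the rows and Bayes' rule for one sample -/

namespace SensorTestProblem

variable {K : ℕ} {X : Type*} [MeasurableSpace X] (M : SensorTestProblem K X)

instance isProbabilityMeasure_arrayLaw (i : Fin 2) : IsProbabilityMeasure (M.arrayLaw i) := by
  unfold arrayLaw
  infer_instance

/-- The samples of round `n` are independent of the earlier ones. -/
theorem indepFun_rows (i : Fin 2) (n : ℕ) :
    ProbabilityTheory.IndepFun (fun (ω : ℕ → Fin K → X) (j : Fin n) => ω j) (fun ω => ω n)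
      (M.arrayLaw i) := by
  have h := ProbabilityTheory.iIndepFun_infinitePi (Ω := fun _ : ℕ => Fin K → X)
    (P := fun _ : ℕ => Measure.pi fun ℓ : Fin K => M.sampleLaw i ℓ)
    (X := fun _ x => x) (fun _ => measurable_id)
  have h' := h.indepFun_finset (Finset.range n) {n} (by simp) (fun k => by fun_prop)
  have e1 : Measurable fun (a : Finset.range n → Fin K → X) (j : Fin n) =>
      a ⟨j, Finset.mem_range.2 j.2⟩ := by fun_prop
  have e2 : Measurable fun (a : ({n} : Finset ℕ) → Fin K → X) =>
      a ⟨n, Finset.mem_singleton_self n⟩ := by fun_prop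
  exact h'.comp e1 e2

/-- The history depends on earlier rows only, so it is independent of row `n` and Fubini applies. Of
that row only the coordinate of the selected sensor enters, and its marginal is the sample law of
that sensor. -/
theorem lintegral_history_succ (p : SequentialProcedure K X) (i : Fin 2) (n : ℕ)
    {g : (Fin (n + 1) → X) → ℝ≥0∞} (hg : Measurable g) :
    ∫⁻ ω, g (p.history ω (n + 1)) ∂(M.arrayLaw i) =
      ∫⁻ ω, ∫⁻ y, g (Fin.snoc (p.history ω n) y)
        ∂(M.sampleLaw i (p.select n (p.history ω n))) ∂(M.arrayLaw i) := by
  have hind : ProbabilityTheory.IndepFun (fun ω => p.history ω n) (fun ω => ω n)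
      (M.arrayLaw i) := by
    simp_rw [p.history_eq_historyOfRows]
    exact (M.indepFun_rows i n).comp (p.measurable_historyOfRows n) measurable_id
  have hmap := (ProbabilityTheory.indepFun_iff_map_prod_eq_prod_map_map
    (p.measurable_history n).aemeasurable (measurable_pi_apply n).aemeasurable).1 hind
  have hrow : (M.arrayLaw i).map (fun ω => ω n) =
      Measure.pi fun ℓ : Fin K => M.sampleLaw i ℓ :=
    (measurePreserving_eval_infinitePi _ n).map_eq
  rw [hrow] at hmap
  have hG : Measurable fun q : (Fin n → X) × (Fin K → X) =>
      g (Fin.snoc q.1 (q.2 (p.select n q.1))) :=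
    hg.comp (SequentialProcedure.measurable_snoc measurable_fst
      (SequentialProcedure.measurable_eval_select measurable_snd
        ((p.measurable_select n).comp measurable_fst)))
  have h1 : ∫⁻ ω, g (p.history ω (n + 1)) ∂(M.arrayLaw i) =
      ∫⁻ q, g (Fin.snoc q.1 (q.2 (p.select n q.1)))
        ∂((M.arrayLaw i).map fun ω => (p.history ω n, ω n)) := by
    rw [lintegral_map hG ((p.measurable_history n).prodMk (measurable_pi_apply n))]
    rfl
  rw [h1, hmap, lintegral_prod _ hG.aemeasurable]
  rw [lintegral_map (hG.lintegral_prod_right') (p.measurable_history n)]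
  refine lintegral_congr fun ω => ?_
  dsimp only
  have hgs : Measurable fun y => g (Fin.snoc (p.history ω n) y) :=
    hg.comp (SequentialProcedure.measurable_snoc measurable_const measurable_id)
  exact (measurePreserving_eval (fun ℓ : Fin K => M.sampleLaw i ℓ)
    (p.select n (p.history ω n))).lintegral_comp hgs

theorem lintegral_sampleLaw (i : Fin 2) (ℓ : Fin K) {g : X → ℝ≥0∞} (hg : Measurable g) :
    ∫⁻ y, g y ∂(M.sampleLaw i ℓ) = ∫⁻ y, M.density i ℓ y * g y ∂M.ref := by
  rw [sampleLaw, lintegral_withDensity_eq_lintegral_mul _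
    (M.measurable_density i ℓ).coe_nnreal_ennreal hg]
  rfl

theorem update_mem_Icc (ℓ : Fin K) {x : ℝ} (hx : x ∈ Icc (0 : ℝ) 1) (y : X) :
    M.update ℓ x y ∈ Icc (0 : ℝ) 1 := by
  have h1 : 0 ≤ (1 - x) * M.density 0 ℓ y := mul_nonneg (by linarith [hx.2]) (NNReal.coe_nonneg _)
  have h2 : 0 ≤ x * M.density 1 ℓ y := mul_nonneg hx.1 (NNReal.coe_nonneg _)
  exact ⟨div_nonneg h2 (by positivity), div_le_one_of_le₀ (by linarith) (by positivity)⟩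

theorem measurable_update (ℓ : Fin K) :
    Measurable fun q : ℝ × X => M.update ℓ q.1 q.2 := by
  have h0 := (M.measurable_density 0 ℓ).coe_nnreal_real
  have h1 := (M.measurable_density 1 ℓ).coe_nnreal_real
  have h0' : Measurable fun q : ℝ × X => (M.density 0 ℓ q.2 : ℝ) := h0.comp measurable_snd
  have h1' : Measurable fun q : ℝ × X => (M.density 1 ℓ q.2 : ℝ) := h1.comp measurable_snd
  exact (measurable_fst.mul h1').div
    (((measurable_fst.const_sub 1).mul h0').add (measurable_fst.mul h1'))

/-- The expectation of `g` over a sample of sensor `ℓ` when the probability of `H_1` is `x`. -/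
noncomputable def mix (x : ℝ) (ℓ : Fin K) (g : X → ℝ≥0∞) : ℝ≥0∞ :=
  ENNReal.ofReal (1 - x) * ∫⁻ y, g y ∂(M.sampleLaw 0 ℓ)
    + ENNReal.ofReal x * ∫⁻ y, g y ∂(M.sampleLaw 1 ℓ)

/-- With a common reference measure, Bayes' rule and later the concavity of the sensor cost become
pointwise statements about the mixture density. -/
theorem mix_eq_lintegral {x : ℝ} (hx : x ∈ Icc (0 : ℝ) 1) (ℓ : Fin K) {g : X → ℝ≥0∞}
    (hg : Measurable g) :
    M.mix x ℓ g = ∫⁻ y, ENNReal.ofReal ((1 - x) * M.density 0 ℓ y + x * M.density 1 ℓ y) * g y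
      ∂M.ref := by
  have h0 := (M.measurable_density 0 ℓ).coe_nnreal_ennreal
  have h1 := (M.measurable_density 1 ℓ).coe_nnreal_ennreal
  have h0' : Measurable fun y => (M.density 0 ℓ y : ℝ≥0∞) * g y := h0.mul hg
  have h1' : Measurable fun y => (M.density 1 ℓ y : ℝ≥0∞) * g y := h1.mul hg
  rw [mix, M.lintegral_sampleLaw 0 ℓ hg, M.lintegral_sampleLaw 1 ℓ hg,
    ← lintegral_const_mul _ h0', ← lintegral_const_mul _ h1',
    ← lintegral_add_left (h0'.const_mul _)]
  refine lintegral_congr fun y => ?_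
  have hx0 : 0 ≤ 1 - x := by linarith [hx.2]
  rw [ENNReal.ofReal_add (by positivity) (mul_nonneg hx.1 (NNReal.coe_nonneg _)),
    ENNReal.ofReal_mul hx0, ENNReal.ofReal_mul hx.1, ENNReal.ofReal_coe_nnreal,
    ENNReal.ofReal_coe_nnreal]
  ring

/-- Bayes' rule for one sample. -/
theorem mix_update_mul {x : ℝ} (hx : x ∈ Icc (0 : ℝ) 1) (ℓ : Fin K) {g : X → ℝ≥0∞}
    (hg : Measurable g) :
    M.mix x ℓ (fun y => ENNReal.ofReal (M.update ℓ x y) * g y) =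
      ENNReal.ofReal x * ∫⁻ y, g y ∂(M.sampleLaw 1 ℓ) := by
  have hu : Measurable fun y => M.update ℓ x y :=
    (M.measurable_update ℓ).comp (measurable_const.prodMk measurable_id)
  have hug : Measurable fun y => ENNReal.ofReal (M.update ℓ x y) * g y := hu.ennreal_ofReal.mul hg
  have hg1 : Measurable fun y => (M.density 1 ℓ y : ℝ≥0∞) * g y :=
    (M.measurable_density 1 ℓ).coe_nnreal_ennreal.mul hg
  rw [M.mix_eq_lintegral hx ℓ hug, M.lintegral_sampleLaw 1 ℓ hg,
    ← lintegral_const_mul _ hg1]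
  refine lintegral_congr fun y => ?_
  have a0 : 0 ≤ (1 - x) * M.density 0 ℓ y := mul_nonneg (by linarith [hx.2]) (NNReal.coe_nonneg _)
  have a1 : 0 ≤ x * M.density 1 ℓ y := mul_nonneg hx.1 (NNReal.coe_nonneg _)
  rw [← mul_assoc, ← mul_assoc, ← ENNReal.ofReal_mul (by positivity),
    ← ENNReal.ofReal_coe_nnreal, ← ENNReal.ofReal_mul hx.1]
  congr 2
  rw [update]
  -- Where the mixture density vanishes, `update` is a division by zero, but both nonnegative
  -- summands are then zero and so are both sides.
  rcases eq_or_ne ((1 - x) * M.density 0 ℓ y + x * M.density 1 ℓ y : ℝ) 0 with h | h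
  · rw [h]
    linarith
  · field_simp

theorem mix_one_sub_update_mul {x : ℝ} (hx : x ∈ Icc (0 : ℝ) 1) (ℓ : Fin K) {g : X → ℝ≥0∞}
    (hg : Measurable g) :
    M.mix x ℓ (fun y => ENNReal.ofReal (1 - M.update ℓ x y) * g y) =
      ENNReal.ofReal (1 - x) * ∫⁻ y, g y ∂(M.sampleLaw 0 ℓ) := by
  have hu : Measurable fun y => M.update ℓ x y :=
    (M.measurable_update ℓ).comp (measurable_const.prodMk measurable_id)
  have hug : Measurable fun y => ENNReal.ofReal (1 - M.update ℓ x y) * g y := (hu.const_sub 1).ennreal_ofReal.mul hg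
  have hg1 : Measurable fun y => (M.density 0 ℓ y : ℝ≥0∞) * g y :=
    (M.measurable_density 0 ℓ).coe_nnreal_ennreal.mul hg
  rw [M.mix_eq_lintegral hx ℓ hug,
    M.lintegral_sampleLaw 0 ℓ hg, ← lintegral_const_mul _ hg1]
  refine lintegral_congr fun y => ?_
  have hx0 : 0 ≤ 1 - x := by linarith [hx.2]
  have a0 : 0 ≤ (1 - x) * M.density 0 ℓ y := mul_nonneg hx0 (NNReal.coe_nonneg _)
  have a1 : 0 ≤ x * M.density 1 ℓ y := mul_nonneg hx.1 (NNReal.coe_nonneg _)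
  rw [← mul_assoc, ← mul_assoc, ← ENNReal.ofReal_mul (by positivity),
    ← ENNReal.ofReal_coe_nnreal, ← ENNReal.ofReal_mul hx0]
  congr 2
  rw [update]
  rcases eq_or_ne ((1 - x) * M.density 0 ℓ y + x * M.density 1 ℓ y : ℝ) 0 with h | h
  · rw [h]
    linarith
  · field_simp
    ring

theorem mix_mono {x : ℝ} (ℓ : Fin K) {g g' : X → ℝ≥0∞} (h : ∀ y, g y ≤ g' y) :
    M.mix x ℓ g ≤ M.mix x ℓ g' := by
  unfold mix
  gcongr <;> exact h _

end SensorTestProblem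

/-! ### The posterior process and the change of measure -/

namespace SequentialProcedure

variable {K : ℕ} {X : Type*} [MeasurableSpace X] (p : SequentialProcedure K X)

/-- The posterior probability of `H_1` after the history `h`, for the prior probability `x`. -/
noncomputable def posterior (M : SensorTestProblem K X) (x : ℝ) : (n : ℕ) → (Fin n → X) → ℝ
  | 0, _ => x
  | n + 1, h => M.update (p.select n (Fin.init h)) (posterior M x n (Fin.init h)) (h (Fin.last n))

theorem posterior_snoc (M : SensorTestProblem K X) (x : ℝ) (n : ℕ) (h : Fin n → X) (y : X) :
    p.posterior M x (n + 1) (Fin.snoc h y) =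
      M.update (p.select n h) (p.posterior M x n h) y := by
  change M.update (p.select n (Fin.init (Fin.snoc h y : Fin (n + 1) → X)))
    (p.posterior M x n (Fin.init (Fin.snoc h y : Fin (n + 1) → X)))
    ((Fin.snoc h y : Fin (n + 1) → X) (Fin.last n)) = _
  rw [Fin.init_snoc, Fin.snoc_last]

theorem snoc_mem_alive {n : ℕ} {h : Fin n → X} {y : X} :
    (Fin.snoc h y : Fin (n + 1) → X) ∈ p.alive (n + 1) ↔ h ∈ p.alive n \ p.stopSet n := by
  change Fin.init (Fin.snoc h y : Fin (n + 1) → X) ∈ p.alive n ∧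
    Fin.init (Fin.snoc h y : Fin (n + 1) → X) ∉ p.stopSet n ↔ _
  rw [Fin.init_snoc]
  rfl

theorem measurable_posterior (M : SensorTestProblem K X) (x : ℝ) (n : ℕ) :
    Measurable (p.posterior M x n) := by
  induction n with
  | zero => exact measurable_const
  | succ n ih =>
    have h : Measurable fun q : (ℝ × X) × Fin K => M.update q.2 q.1.1 q.1.2 :=
      measurable_from_prod_countable_left fun ℓ => M.measurable_update ℓ
    exact h.comp (((ih.comp measurable_init).prodMk (measurable_pi_apply _)).prodMk
      ((p.measurable_select n).comp measurable_init))

theorem posterior_mem_Icc (M : SensorTestProblem K X) {x : ℝ} (hx : x ∈ Icc (0 : ℝ) 1) (n : ℕ)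
    (h : Fin n → X) : p.posterior M x n h ∈ Icc (0 : ℝ) 1 := by
  induction n with
  | zero => exact hx
  | succ n ih => exact M.update_mem_Icc _ (ih _) _

end SequentialProcedure

namespace SensorTestProblem

variable {K : ℕ} {X : Type*} [MeasurableSpace X] (M : SensorTestProblem K X)

/-- The law of the array of samples when the prior probability of `H_1` is `x`. -/
noncomputable def bayesLaw (x : ℝ) : Measure (ℕ → Fin K → X) :=
  ENNReal.ofReal (1 - x) • M.arrayLaw 0 + ENNReal.ofReal x • M.arrayLaw 1

theorem expect_eq_lintegral (x : ℝ) (g : (ℕ → Fin K → X) → ℝ≥0∞) :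
    M.expect x g = ∫⁻ ω, g ω ∂(M.bayesLaw x) := by
  rw [expect, bayesLaw, lintegral_add_measure, lintegral_smul_measure, lintegral_smul_measure,
    smul_eq_mul, smul_eq_mul]

theorem ofReal_one_sub_add {x : ℝ} (hx : x ∈ Icc (0 : ℝ) 1) :
    ENNReal.ofReal (1 - x) + ENNReal.ofReal x = 1 := by
  rw [← ENNReal.ofReal_add (by linarith [hx.2]) hx.1]
  simp

theorem isProbabilityMeasure_bayesLaw {x : ℝ} (hx : x ∈ Icc (0 : ℝ) 1) :
    IsProbabilityMeasure (M.bayesLaw x) :=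
  ⟨by simp [bayesLaw, ofReal_one_sub_add hx]⟩

theorem measurable_lintegral_sampleLaw_const {α : Type*} [MeasurableSpace α] (i : Fin 2) (ℓ : Fin K)
    {F : α × X → ℝ≥0∞} (hF : Measurable F) :
    Measurable fun a => ∫⁻ y, F (a, y) ∂(M.sampleLaw i ℓ) :=
  hF.lintegral_prod_right'

theorem measurable_lintegral_sampleLaw_prod {α : Type*} [MeasurableSpace α] (i : Fin 2)
    {F : α × X → ℝ≥0∞} (hF : Measurable F) :
    Measurable fun q : α × Fin K => ∫⁻ y, F (q.1, y) ∂(M.sampleLaw i q.2) := by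
  apply measurable_from_prod_countable_left
  intro ℓ
  exact M.measurable_lintegral_sampleLaw_const i ℓ hF

theorem measurable_lintegral_sampleLaw {α : Type*} [MeasurableSpace α] (i : Fin 2) {s : α → Fin K}
    (hs : Measurable s) {F : α × X → ℝ≥0∞} (hF : Measurable F) :
    Measurable fun a => ∫⁻ y, F (a, y) ∂(M.sampleLaw i (s a)) := by
  have h := (M.measurable_lintegral_sampleLaw_prod i hF).comp (measurable_id.prodMk hs)
  exact h

theorem measurable_lintegral_snoc (p : SequentialProcedure K X) (i : Fin 2) (n : ℕ)
    {g : (Fin (n + 1) → X) → ℝ≥0∞} (hg : Measurable g) :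
    Measurable fun h : Fin n → X =>
      ∫⁻ y, g (Fin.snoc h y) ∂(M.sampleLaw i (p.select n h)) := by
  have h1 : Measurable fun q : (Fin n → X) × X => (Fin.snoc q.1 q.2 : Fin (n + 1) → X) :=
    SequentialProcedure.measurable_snoc measurable_fst measurable_snd
  exact M.measurable_lintegral_sampleLaw i (p.measurable_select n) (hg.comp h1)

/-- The hypotheses are the change of measure at length `n`. They turn the prior weights in front of
the two array laws into posterior weights under `bayesLaw`, which combine to `mix`. -/
theorem lintegral_history_succ_bayesLaw_aux (p : SequentialProcedure K X) {x : ℝ} (n : ℕ)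
    (h0 : ∀ G : (Fin n → X) → ℝ≥0∞, Measurable G →
      ENNReal.ofReal (1 - x) * ∫⁻ ω, G (p.history ω n) ∂(M.arrayLaw 0) =
        ∫⁻ ω, ENNReal.ofReal (1 - p.posterior M x n (p.history ω n)) * G (p.history ω n)
          ∂(M.bayesLaw x))
    (h1 : ∀ G : (Fin n → X) → ℝ≥0∞, Measurable G →
      ENNReal.ofReal x * ∫⁻ ω, G (p.history ω n) ∂(M.arrayLaw 1) =
        ∫⁻ ω, ENNReal.ofReal (p.posterior M x n (p.history ω n)) * G (p.history ω n)
          ∂(M.bayesLaw x))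
    {g : (Fin (n + 1) → X) → ℝ≥0∞} (hg : Measurable g) :
    ∫⁻ ω, g (p.history ω (n + 1)) ∂(M.bayesLaw x) =
      ∫⁻ ω, M.mix (p.posterior M x n (p.history ω n)) (p.select n (p.history ω n))
        (fun y => g (Fin.snoc (p.history ω n) y)) ∂(M.bayesLaw x) := by
  have hk0 := M.measurable_lintegral_snoc p 0 n hg
  have hk1 := M.measurable_lintegral_snoc p 1 n hg
  rw [← expect_eq_lintegral, expect, M.lintegral_history_succ p 0 n hg,
    M.lintegral_history_succ p 1 n hg, h0 _ hk0, h1 _ hk1]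
  have hm : Measurable fun ω => ENNReal.ofReal (1 - p.posterior M x n (p.history ω n)) *
      ∫⁻ y, g (Fin.snoc (p.history ω n) y) ∂(M.sampleLaw 0 (p.select n (p.history ω n))) :=
    ((((p.measurable_posterior M x n).comp (p.measurable_history n)).const_sub
    1).ennreal_ofReal.mul (hk0.comp (p.measurable_history n)))
  rw [← lintegral_add_left hm]
  rfl

/-- The recursively defined posterior probability is the conditional probability of the hypotheses
given the history. -/
theorem ofReal_mul_lintegral_history (p : SequentialProcedure K X) {x : ℝ}
    (hx : x ∈ Icc (0 : ℝ) 1) (n : ℕ) :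
    (∀ G : (Fin n → X) → ℝ≥0∞, Measurable G →
      ENNReal.ofReal (1 - x) * ∫⁻ ω, G (p.history ω n) ∂(M.arrayLaw 0) =
        ∫⁻ ω, ENNReal.ofReal (1 - p.posterior M x n (p.history ω n)) * G (p.history ω n)
          ∂(M.bayesLaw x)) ∧
    (∀ G : (Fin n → X) → ℝ≥0∞, Measurable G →
      ENNReal.ofReal x * ∫⁻ ω, G (p.history ω n) ∂(M.arrayLaw 1) =
        ∫⁻ ω, ENNReal.ofReal (p.posterior M x n (p.history ω n)) * G (p.history ω n)
          ∂(M.bayesLaw x)) := by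
  -- Both identities go through the induction together: the transition under `bayesLaw` at length
  -- `n` needs the two of them, even to advance only one.
  induction n with
  | zero =>
    have := M.isProbabilityMeasure_bayesLaw hx
    have hc : ∀ ω : ℕ → Fin K → X, p.history ω 0 = Fin.elim0 := fun _ => rfl
    constructor <;> intro G _ <;> simp [hc, SequentialProcedure.posterior]
  | succ n ih =>
    obtain ⟨ih0, ih1⟩ := ih
    have hs : ∀ {G : (Fin (n + 1) → X) → ℝ≥0∞}, Measurable G → ∀ h : Fin n → X,
        Measurable fun y => G (Fin.snoc h y) := fun hG h =>
      hG.comp (SequentialProcedure.measurable_snoc measurable_const measurable_id)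
    have hp := p.measurable_posterior M x (n + 1)
    constructor
    · intro G hG
      have hm : Measurable fun h : Fin (n + 1) → X =>
        ENNReal.ofReal (1 - p.posterior M x (n + 1) h) * G h :=
        (hp.const_sub 1).ennreal_ofReal.mul hG
      rw [M.lintegral_history_succ_bayesLaw_aux p n ih0 ih1 hm, M.lintegral_history_succ p 0 n hG,
        ih0 _ (M.measurable_lintegral_snoc p 0 n hG)]
      refine lintegral_congr fun ω => ?_
      simp_rw [p.posterior_snoc]
      exact (M.mix_one_sub_update_mul (p.posterior_mem_Icc M hx n _) _ (hs hG _)).symm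
    · intro G hG
      have hm : Measurable fun h : Fin (n + 1) → X =>
        ENNReal.ofReal (p.posterior M x (n + 1) h) * G h :=
        hp.ennreal_ofReal.mul hG
      rw [M.lintegral_history_succ_bayesLaw_aux p n ih0 ih1 hm, M.lintegral_history_succ p 1 n hG,
        ih1 _ (M.measurable_lintegral_snoc p 1 n hG)]
      refine lintegral_congr fun ω => ?_
      simp_rw [p.posterior_snoc]
      exact (M.mix_update_mul (p.posterior_mem_Icc M hx n _) _ (hs hG _)).symm

theorem lintegral_history_succ_bayesLaw (p : SequentialProcedure K X) {x : ℝ}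
    (hx : x ∈ Icc (0 : ℝ) 1) (n : ℕ) {g : (Fin (n + 1) → X) → ℝ≥0∞} (hg : Measurable g) :
    ∫⁻ ω, g (p.history ω (n + 1)) ∂(M.bayesLaw x) =
      ∫⁻ ω, M.mix (p.posterior M x n (p.history ω n)) (p.select n (p.history ω n))
        (fun y => g (Fin.snoc (p.history ω n) y)) ∂(M.bayesLaw x) :=
  M.lintegral_history_succ_bayesLaw_aux p n (M.ofReal_mul_lintegral_history p hx n).1
    (M.ofReal_mul_lintegral_history p hx n).2 hg

/-! ### The risk as a sum of stage costs -/

/-- The expected loss of accepting the hypothesis `j` when the probability of `H_1` is `x`. -/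
noncomputable def decisionCost (j : Fin 2) (x : ℝ) : ℝ≥0∞ :=
  if j = 1 then M.μ₀ * ENNReal.ofReal (1 - x) else M.μ₁ * ENNReal.ofReal x

open Classical in
/-- The expected cost incurred between samples `n` and `n + 1`, given the history `h`. -/
noncomputable def stageCost (p : SequentialProcedure K X) (x : ℝ) (n : ℕ) (h : Fin n → X) :
    ℝ≥0∞ :=
  (p.alive n).indicator (fun h => if h ∈ p.stopSet n then
    M.decisionCost (p.decide n h) (p.posterior M x n h)
    else ENNReal.ofReal (M.sampleCost (p.select n h))) h

theorem measurable_stageCost (p : SequentialProcedure K X) (x : ℝ) (n : ℕ) :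
    Measurable (M.stageCost p x n) := by
  classical
  have hp := p.measurable_posterior M x n
  refine Measurable.indicator ?_ (p.measurableSet_alive n)
  refine Measurable.ite (p.measurableSet_stopSet n) ?_ ?_
  · exact Measurable.ite (p.measurable_decide n (measurableSet_singleton 1))
      ((hp.const_sub 1).ennreal_ofReal.const_mul _) (hp.ennreal_ofReal.const_mul _)
  · exact (measurable_of_finite fun ℓ => ENNReal.ofReal (M.sampleCost ℓ)).comp
      (p.measurable_select n)

theorem ofReal_sampleCost (ℓ : Fin K) : ENNReal.ofReal (M.sampleCost ℓ) =
    1 + ∑ k ∈ M.constrained, M.lam k * if ℓ = k then 1 else 0 := by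
  rw [sampleCost, ENNReal.ofReal_add zero_le_one (by split_ifs <;> simp)]
  simp only [ENNReal.ofReal_one, mul_ite, mul_one, mul_zero, Finset.sum_ite_eq]
  split_ifs <;> simp

theorem measure_acceptEvent (p : SequentialProcedure K X) (i j : Fin 2) :
    M.arrayLaw i (p.acceptEvent j) = ∑' n : ℕ, ∫⁻ ω,
      (p.alive n ∩ p.stopSet n ∩ {h | p.decide n h = j}).indicator 1 (p.history ω n)
        ∂(M.arrayLaw i) := by
  have hS : ∀ n, MeasurableSet (p.alive n ∩ p.stopSet n ∩ {h | p.decide n h = j}) := fun n =>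
    ((p.measurableSet_alive n).inter (p.measurableSet_stopSet n)).inter
      (p.measurable_decide n (measurableSet_singleton j))
  have h1 : p.acceptEvent j = ⋃ n : ℕ, (fun ω => p.history ω n) ⁻¹'
      (p.alive n ∩ p.stopSet n ∩ {h | p.decide n h = j}) := by
    ext ω
    simp only [SequentialProcedure.acceptEvent, p.stopTime_eq_coe_iff, mem_ofPred_eq, mem_iUnion,
      mem_preimage, mem_inter_iff]
  rw [h1, measure_iUnion]
  · refine tsum_congr fun n => ?_
    rw [← lintegral_indicator_one (p.measurable_history n (hS n))]
    rfl
  · intro m n hmn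
    refine disjoint_left.2 fun ω hm hn => hmn ?_
    have e1 := p.stopTime_eq_coe_iff.2 hm.1
    have e2 := p.stopTime_eq_coe_iff.2 hn.1
    exact_mod_cast e1.symm.trans e2
  · exact fun n => p.measurable_history n (hS n)

/-- Every term of the risk splits over time: `T` and the usages count the times before stopping, and
the acceptance events are disjoint unions over the stopping time. The change of measure replaces
each error probability by an expected posterior loss, so all terms live under the single law
`bayesLaw x`. -/
theorem risk_eq_tsum (p : SequentialProcedure K X) {x : ℝ} (hx : x ∈ Icc (0 : ℝ) 1) :
    M.risk x p = ∑' n : ℕ, ∫⁻ ω, M.stageCost p x n (p.history ω n) ∂(M.bayesLaw x) := by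
  classical
  have hind : ∀ (n : ℕ) (S : Set (Fin n → X)), MeasurableSet S →
      Measurable fun ω => S.indicator (1 : (Fin n → X) → ℝ≥0∞) (p.history ω n) := fun n S hS =>
    (measurable_const.indicator hS).comp (p.measurable_history n)
  have hC : ∀ n, MeasurableSet (p.alive n \ p.stopSet n) := fun n =>
    (p.measurableSet_alive n).diff (p.measurableSet_stopSet n)
  have hD : ∀ n j, MeasurableSet (p.alive n ∩ p.stopSet n ∩ {h | p.decide n h = j}) := fun n j =>
    ((p.measurableSet_alive n).inter (p.measurableSet_stopSet n)).inter
      (p.measurable_decide n (measurableSet_singleton j))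
  have hL : ∀ n ℓ, MeasurableSet ((p.alive n \ p.stopSet n) ∩ {h | p.select n h = ℓ}) := fun n ℓ =>
    (hC n).inter (p.measurable_select n (measurableSet_singleton ℓ))
  have hT : M.expect x (fun ω => (p.stopTime ω : ℝ≥0∞)) = ∑' n : ℕ, ∫⁻ ω,
      (p.alive n \ p.stopSet n).indicator 1 (p.history ω n) ∂(M.bayesLaw x) := by
    rw [expect_eq_lintegral, ← lintegral_tsum fun n => (hind n _ (hC n)).aemeasurable]
    refine lintegral_congr fun ω => ?_
    rw [p.stopTime_toENNReal]
    refine tsum_congr fun n => ?_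
    simp only [indicator, p.history_succ_mem_alive, Set.mem_sdiff, Pi.one_apply]
  have hU : ∀ ℓ, M.expect x (p.usage ℓ) = ∑' n : ℕ, ∫⁻ ω,
      ((p.alive n \ p.stopSet n) ∩ {h | p.select n h = ℓ}).indicator 1 (p.history ω n)
        ∂(M.bayesLaw x) := by
    intro ℓ
    rw [expect_eq_lintegral, ← lintegral_tsum fun n => (hind n _ (hL n ℓ)).aemeasurable]
    refine lintegral_congr fun ω => ?_
    refine tsum_congr fun n => ?_
    simp only [indicator, p.lt_stopTime_iff, Set.mem_sdiff, mem_inter_iff, Pi.one_apply,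
      mem_ofPred_eq, SequentialProcedure.sensor]
  have h0 : ∀ n, ENNReal.ofReal (1 - x) * ∫⁻ ω,
      (p.alive n ∩ p.stopSet n ∩ {h | p.decide n h = 1}).indicator 1 (p.history ω n)
        ∂(M.arrayLaw 0) = _ := fun n =>
    (M.ofReal_mul_lintegral_history p hx n).1 _ (measurable_const.indicator (hD n 1))
  have h1 : ∀ n, ENNReal.ofReal x * ∫⁻ ω,
      (p.alive n ∩ p.stopSet n ∩ {h | p.decide n h = 0}).indicator 1 (p.history ω n)
        ∂(M.arrayLaw 1) = _ := fun n =>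
    (M.ofReal_mul_lintegral_history p hx n).2 _ (measurable_const.indicator (hD n 0))
  have hpost : ∀ n, Measurable fun ω => p.posterior M x n (p.history ω n) := fun n =>
    (p.measurable_posterior M x n).comp (p.measurable_history n)
  rw [risk, hT, M.measure_acceptEvent, M.measure_acceptEvent, mul_assoc, mul_assoc,
    ← ENNReal.tsum_mul_left, ← ENNReal.tsum_mul_left, ← ENNReal.tsum_mul_left,
    ← ENNReal.tsum_mul_left]
  simp_rw [h0, h1, hU, ← ENNReal.tsum_mul_left]
  rw [← Summable.tsum_finsetSum fun _ _ => ENNReal.summable, ← ENNReal.tsum_add,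
    ← ENNReal.tsum_add, ← ENNReal.tsum_add]
  refine tsum_congr fun n => ?_
  have m1 := hind n _ (hD n 1)
  have m0 := hind n _ (hD n 0)
  have mp0 : Measurable fun ω => ENNReal.ofReal (1 - p.posterior M x n (p.history ω n)) *
      (p.alive n ∩ p.stopSet n ∩ {h | p.decide n h = 1}).indicator 1 (p.history ω n) :=
    ((hpost n).const_sub 1).ennreal_ofReal.mul m1
  have mp1 : Measurable fun ω => ENNReal.ofReal (p.posterior M x n (p.history ω n)) *
      (p.alive n ∩ p.stopSet n ∩ {h | p.decide n h = 0}).indicator 1 (p.history ω n) :=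
    (hpost n).ennreal_ofReal.mul m0
  rw [← lintegral_const_mul _ mp0, ← lintegral_const_mul _ mp1]
  simp_rw [← lintegral_const_mul _ (hind n _ (hL n _))]
  rw [← lintegral_finsetSum _ fun ℓ _ => (hind n _ (hL n ℓ)).const_mul _,
    ← lintegral_add_right _ (mp0.const_mul _), ← lintegral_add_right _ (mp1.const_mul _),
    ← lintegral_add_right _ (Finset.measurable_fun_sum _ fun ℓ _ => (hind n _ (hL n ℓ)).const_mul _)]
  refine lintegral_congr fun ω => ?_
  generalize p.history ω n = h
  by_cases ha : h ∈ p.alive n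
  · by_cases hs : h ∈ p.stopSet n
    · have hd : p.decide n h = 0 ∨ p.decide n h = 1 := by
        generalize p.decide n h = j
        fin_cases j <;> simp
      rcases hd with hd | hd <;> simp [stageCost, decisionCost, ha, hs, hd, indicator]
    · simp [stageCost, ha, hs, M.ofReal_sampleCost, indicator]
      split_ifs <;> rfl
  · simp [stageCost, ha]

end SensorTestProblem

/-! ### Truncation at a finite horizon -/

namespace SequentialProcedure

variable {K : ℕ} {X : Type*} [MeasurableSpace X] (p : SequentialProcedure K X)

open Classical in
/-- The procedure `p`, stopped after `N` samples at the latest. -/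
noncomputable def truncate (N : ℕ) : SequentialProcedure K X where
  select := p.select
  measurable_select := p.measurable_select
  stopSet n := if N ≤ n then univ else p.stopSet n
  measurableSet_stopSet n := by
    split_ifs
    · exact MeasurableSet.univ
    · exact p.measurableSet_stopSet n
  decide := p.decide
  measurable_decide := p.measurable_decide

theorem history_truncate (N : ℕ) (ω : ℕ → Fin K → X) (n : ℕ) :
    (p.truncate N).history ω n = p.history ω n := by
  induction n with
  | zero => rfl
  | succ n ih =>
    rw [history, history, ih]
    rfl

theorem stopTime_truncate_le (N : ℕ) (ω : ℕ → Fin K → X) : (p.truncate N).stopTime ω ≤ N := by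
  refine iInf₂_le N ?_
  simp [truncate]

theorem stopTime_truncate_le_stopTime (N : ℕ) (ω : ℕ → Fin K → X) :
    (p.truncate N).stopTime ω ≤ p.stopTime ω := by
  refine iInf_mono fun n => iInf_mono' fun h => ⟨?_, le_rfl⟩
  rw [history_truncate]
  simp only [truncate]
  split_ifs
  · trivial
  · exact h

theorem stopTime_of_stopTime_truncate {N n : ℕ} {ω : ℕ → Fin K → X}
    (h : (p.truncate N).stopTime ω = n) : p.stopTime ω = n ∨ (N : ℕ∞) ≤ p.stopTime ω := by
  have hn : n ≤ N := by
    have := h ▸ p.stopTime_truncate_le N ω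
    exact_mod_cast this
  rcases hn.lt_or_eq with hlt | rfl
  · left
    rw [stopTime_eq_coe_iff, history_mem_alive_iff] at h ⊢
    simp only [history_truncate] at h
    refine ⟨fun k hk => ?_, ?_⟩
    · simpa [truncate, (hk.trans hlt).not_ge] using h.1 k hk
    · simpa [truncate, hlt.not_ge] using h.2
  · right
    rw [← h]
    exact p.stopTime_truncate_le_stopTime n ω

theorem acceptEvent_truncate_subset (N : ℕ) (j : Fin 2) :
    (p.truncate N).acceptEvent j ⊆ p.acceptEvent j ∪ {ω | p.history ω N ∈ p.alive N} := by
  rintro ω ⟨n, hn, hd⟩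
  rcases p.stopTime_of_stopTime_truncate hn with h | h
  · left
    rw [history_truncate] at hd
    exact ⟨n, h, hd⟩
  · right
    exact p.le_stopTime_iff.1 h

theorem usage_truncate_le (N : ℕ) (ℓ : Fin K) (ω : ℕ → Fin K → X) :
    (p.truncate N).usage ℓ ω ≤ p.usage ℓ ω := by
  refine ENNReal.tsum_le_tsum fun t => ?_
  have hs : (p.truncate N).sensor ω t = p.sensor ω t := by
    rw [sensor, history_truncate]
    rfl
  rw [hs]
  split_ifs with h1 h2
  · exact le_rfl
  · exact absurd ⟨h1.1.trans_le (p.stopTime_truncate_le_stopTime N ω), h1.2⟩ h2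
  · exact zero_le
  · exact le_rfl

end SequentialProcedure

namespace SensorTestProblem

variable {K : ℕ} {X : Type*} [MeasurableSpace X] (M : SensorTestProblem K X)

/-- The probability that the procedure takes at least `n` samples. -/
noncomputable def aliveProb (p : SequentialProcedure K X) (x : ℝ) (n : ℕ) : ℝ≥0∞ :=
  M.bayesLaw x {ω | p.history ω n ∈ p.alive n}

theorem expect_stopTime (p : SequentialProcedure K X) (x : ℝ) :
    M.expect x (fun ω => (p.stopTime ω : ℝ≥0∞)) = ∑' n : ℕ, M.aliveProb p x (n + 1) := by
  simp_rw [expect_eq_lintegral, p.stopTime_toENNReal]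
  have hm : ∀ n, Measurable fun ω => (p.alive (n + 1)).indicator
      (1 : (Fin (n + 1) → X) → ℝ≥0∞) (p.history ω (n + 1)) := fun n =>
    (measurable_const.indicator (p.measurableSet_alive (n + 1))).comp (p.measurable_history (n + 1))
  rw [lintegral_tsum fun n => (hm n).aemeasurable]
  refine tsum_congr fun n => ?_
  have hS : MeasurableSet {ω | p.history ω (n + 1) ∈ p.alive (n + 1)} :=
    p.measurable_history _ (p.measurableSet_alive _)
  rw [aliveProb, ← lintegral_indicator_one hS]
  rfl

/-- The risk dominates the expected sample size, which is the sum of these tail probabilities. -/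
theorem tendsto_aliveProb {p : SequentialProcedure K X} {x : ℝ} (h : M.risk x p ≠ ⊤) :
    Tendsto (M.aliveProb p x) atTop (𝓝 0) := by
  have h1 : ∑' n : ℕ, M.aliveProb p x (n + 1) ≠ ⊤ := by
    rw [← expect_stopTime]
    refine ne_top_of_le_ne_top h ?_
    rw [risk, add_assoc, add_assoc]
    exact le_self_add
  exact (tendsto_add_atTop_iff_nat 1).1 (ENNReal.tendsto_atTop_zero_of_tsum_ne_top h1)

theorem expect_mono {x : ℝ} {g g' : (ℕ → Fin K → X) → ℝ≥0∞} (h : ∀ ω, g ω ≤ g' ω) :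
    M.expect x g ≤ M.expect x g' := by
  unfold expect
  gcongr <;> exact h _

/-- Truncation lowers the sample size and the usages. It can add errors only on the event that `N`
samples are taken, and each error type is charged separately. -/
theorem risk_truncate_le (p : SequentialProcedure K X) (x : ℝ) (N : ℕ) :
    M.risk x (p.truncate N) ≤ M.risk x p + (M.μ₀ + M.μ₁) * M.aliveProb p x N := by
  have h : ∀ i j, M.arrayLaw i ((p.truncate N).acceptEvent j) ≤
      M.arrayLaw i (p.acceptEvent j) + M.arrayLaw i {ω | p.history ω N ∈ p.alive N} := fun i j =>
    (measure_mono (p.acceptEvent_truncate_subset N j)).trans (measure_union_le _ _)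
  have h0 : ENNReal.ofReal (1 - x) * M.arrayLaw 0 {ω | p.history ω N ∈ p.alive N} ≤
      M.aliveProb p x N := by
    simp [aliveProb, bayesLaw]
  have h1 : ENNReal.ofReal x * M.arrayLaw 1 {ω | p.history ω N ∈ p.alive N} ≤
      M.aliveProb p x N := by
    simp [aliveProb, bayesLaw]
  calc M.risk x (p.truncate N)
      ≤ M.expect x (fun ω => (p.stopTime ω : ℝ≥0∞))
        + M.μ₀ * ENNReal.ofReal (1 - x) * (M.arrayLaw 0 (p.acceptEvent 1) +
            M.arrayLaw 0 {ω | p.history ω N ∈ p.alive N})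
        + M.μ₁ * ENNReal.ofReal x * (M.arrayLaw 1 (p.acceptEvent 0) +
            M.arrayLaw 1 {ω | p.history ω N ∈ p.alive N})
        + ∑ ℓ ∈ M.constrained, M.lam ℓ * M.expect x (p.usage ℓ) := by
        unfold risk
        gcongr with ℓ
        · exact M.expect_mono fun ω =>
            ENat.toENNReal_le.2 (p.stopTime_truncate_le_stopTime N ω)
        · exact h 0 1
        · exact h 1 0
        · exact M.expect_mono fun ω => p.usage_truncate_le N ℓ ω
    _ = M.risk x p
        + (M.μ₀ * (ENNReal.ofReal (1 - x) * M.arrayLaw 0 {ω | p.history ω N ∈ p.alive N})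
        + M.μ₁ * (ENNReal.ofReal x * M.arrayLaw 1 {ω | p.history ω N ∈ p.alive N})) := by
        unfold risk
        ring
    _ ≤ _ := by
        rw [add_mul]
        gcongr

/-! ### Verification: bounds on the risk from the Bellman equation -/

/-- The cost of one more sample from sensor `ℓ`, with the extended cost-to-go `w`. -/
noncomputable def sensorCostENNReal (w : ℝ → ℝ≥0∞) (x : ℝ) (ℓ : Fin K) : ℝ≥0∞ :=
  ENNReal.ofReal (M.sampleCost ℓ) + M.mix x ℓ fun y => w (M.update ℓ x y)

/-- The expected cost-to-go `w` after `n` samples, if the procedure takes so many. -/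
noncomputable def residualCost (p : SequentialProcedure K X) (x : ℝ) (w : ℝ → ℝ≥0∞) (n : ℕ) :
    ℝ≥0∞ :=
  ∫⁻ ω, (p.alive n).indicator (fun h => w (p.posterior M x n h)) (p.history ω n) ∂(M.bayesLaw x)

theorem mix_zero (x : ℝ) (ℓ : Fin K) : M.mix x ℓ (fun _ => 0) = 0 := by
  simp [mix]

-- The one-step identity of dynamic programming: conditioning on the first `n` samples merges the
-- sampling cost and the expected cost-to-go into the sensor cost. After stopping no cost-to-go
-- remains.
open Classical in
theorem lintegral_stageCost_add_residualCost (p : SequentialProcedure K X) {x : ℝ}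
    (hx : x ∈ Icc (0 : ℝ) 1) {w : ℝ → ℝ≥0∞} (hw : Measurable w) (n : ℕ) :
    (∫⁻ ω, M.stageCost p x n (p.history ω n) ∂(M.bayesLaw x)) + M.residualCost p x w (n + 1) =
      ∫⁻ ω, (p.alive n).indicator (fun h => if h ∈ p.stopSet n then
        M.decisionCost (p.decide n h) (p.posterior M x n h)
        else M.sensorCostENNReal w (p.posterior M x n h) (p.select n h)) (p.history ω n)
        ∂(M.bayesLaw x) := by
  have hm : Measurable fun h : Fin (n + 1) → X =>
      (p.alive (n + 1)).indicator (fun h => w (p.posterior M x (n + 1) h)) h :=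
    (hw.comp (p.measurable_posterior M x (n + 1))).indicator (p.measurableSet_alive (n + 1))
  have hs : Measurable fun ω => M.stageCost p x n (p.history ω n) :=
    (M.measurable_stageCost p x n).comp (p.measurable_history n)
  rw [residualCost, M.lintegral_history_succ_bayesLaw p hx n hm, ← lintegral_add_left hs]
  refine lintegral_congr fun ω => ?_
  generalize p.history ω n = h
  simp only [indicator, p.snoc_mem_alive, p.posterior_snoc]
  by_cases ha : h ∈ p.alive n
  · by_cases hs : h ∈ p.stopSet n
    · simp [stageCost, ha, hs, mix_zero]
    · simp [stageCost, ha, hs, sensorCostENNReal]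
  · simp [stageCost, ha, mix_zero]

theorem residualCost_zero (p : SequentialProcedure K X) {x : ℝ} (hx : x ∈ Icc (0 : ℝ) 1)
    (w : ℝ → ℝ≥0∞) : M.residualCost p x w 0 = w x := by
  have := M.isProbabilityMeasure_bayesLaw hx
  simp [residualCost, SequentialProcedure.alive, SequentialProcedure.posterior]

theorem residualCost_le {p : SequentialProcedure K X} {x : ℝ} (hx : x ∈ Icc (0 : ℝ) 1)
    {w : ℝ → ℝ≥0∞} {c : ℝ≥0∞} (hc : ∀ z ∈ Icc (0 : ℝ) 1, w z ≤ c) (n : ℕ) :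
    M.residualCost p x w n ≤ c * M.aliveProb p x n := by
  have hS : MeasurableSet {ω | p.history ω n ∈ p.alive n} :=
    p.measurable_history n (p.measurableSet_alive n)
  rw [aliveProb, ← lintegral_indicator_const hS]
  refine lintegral_mono fun ω => ?_
  simp only [indicator, mem_ofPred_eq]
  split_ifs
  · exact hc _ (p.posterior_mem_Icc M hx n _)
  · exact le_rfl

theorem ofReal_stopCost_le_decisionCost (j : Fin 2) (x : ℝ) :
    ENNReal.ofReal (M.stopCost x) ≤ M.decisionCost j x := by
  rw [decisionCost, stopCost]
  split_ifs
  · rw [← ENNReal.ofReal_coe_nnreal (p := M.μ₀), ← ENNReal.ofReal_mul (NNReal.coe_nonneg _)]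
    exact ENNReal.ofReal_le_ofReal (min_le_right _ _)
  · rw [← ENNReal.ofReal_coe_nnreal (p := M.μ₁), ← ENNReal.ofReal_mul (NNReal.coe_nonneg _)]
    exact ENNReal.ofReal_le_ofReal (min_le_left _ _)

/-- A bounded subsolution of the Bellman equation is a lower bound of the Bayes risk. -/
theorem le_risk {x : ℝ} (hx : x ∈ Icc (0 : ℝ) 1) {w : ℝ → ℝ≥0∞} (hw : Measurable w) {c : ℝ≥0∞}
    (hc : c ≠ ⊤) (hwc : ∀ z ∈ Icc (0 : ℝ) 1, w z ≤ c)
    (hterminal : ∀ z ∈ Icc (0 : ℝ) 1, w z ≤ ENNReal.ofReal (M.stopCost z))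
    (hcont : ∀ z ∈ Icc (0 : ℝ) 1, ∀ ℓ, w z ≤ M.sensorCostENNReal w z ℓ)
    (p : SequentialProcedure K X) : w x ≤ M.risk x p := by
  classical
  by_cases htop : M.risk x p = ⊤
  · rw [htop]
    exact le_top
  have hstep : ∀ n, M.residualCost p x w n ≤
      (∫⁻ ω, M.stageCost p x n (p.history ω n) ∂(M.bayesLaw x)) +
        M.residualCost p x w (n + 1) := by
    intro n
    rw [M.lintegral_stageCost_add_residualCost p hx hw n]
    refine lintegral_mono fun ω => indicator_le_indicator ?_
    have hz := p.posterior_mem_Icc M hx n (p.history ω n)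
    split_ifs
    · exact (hterminal _ hz).trans (M.ofReal_stopCost_le_decisionCost _ _)
    · exact hcont _ hz _
  have hsum : ∀ n, w x ≤ (∑ k ∈ Finset.range n,
      ∫⁻ ω, M.stageCost p x k (p.history ω k) ∂(M.bayesLaw x)) + M.residualCost p x w n := by
    intro n
    induction n with
    | zero => simp [M.residualCost_zero p hx w]
    | succ n ih =>
      rw [Finset.sum_range_succ, add_assoc]
      exact ih.trans (by gcongr; exact hstep n)
  have hle : ∀ n, w x ≤ M.risk x p + c * M.aliveProb p x n := fun n => by
    refine (hsum n).trans (add_le_add ?_ (M.residualCost_le hx hwc n))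
    rw [M.risk_eq_tsum p hx]
    exact ENNReal.sum_le_tsum _
  -- The remainder is at most `c` times the probability of taking `n` samples, which tends to 0 for
  -- finite risk.
  have hlim : Tendsto (fun n => M.risk x p + c * M.aliveProb p x n) atTop
      (𝓝 (M.risk x p + c * 0)) :=
    (ENNReal.Tendsto.const_mul (M.tendsto_aliveProb htop) (Or.inr hc)).const_add _
  rw [mul_zero, add_zero] at hlim
  exact ge_of_tendsto' hlim hle

/-- A procedure that attains the Bellman equation along its histories has at most the cost that the
equation predicts. -/
theorem risk_le {x : ℝ} (hx : x ∈ Icc (0 : ℝ) 1) {w : ℝ → ℝ≥0∞} (hw : Measurable w)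
    (p : SequentialProcedure K X)
    (hterminal : ∀ n, ∀ h ∈ p.alive n, h ∈ p.stopSet n →
      M.decisionCost (p.decide n h) (p.posterior M x n h) ≤ w (p.posterior M x n h))
    (hcont : ∀ n, ∀ h ∈ p.alive n, h ∉ p.stopSet n →
      M.sensorCostENNReal w (p.posterior M x n h) (p.select n h) ≤ w (p.posterior M x n h)) :
    M.risk x p ≤ w x := by
  classical
  have hstep : ∀ n, (∫⁻ ω, M.stageCost p x n (p.history ω n) ∂(M.bayesLaw x)) +
        M.residualCost p x w (n + 1) ≤ M.residualCost p x w n := by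
    intro n
    rw [M.lintegral_stageCost_add_residualCost p hx hw n]
    refine lintegral_mono fun ω => ?_
    generalize p.history ω n = h
    by_cases ha : h ∈ p.alive n
    · simp only [indicator_of_mem ha]
      split_ifs with hs
      · exact hterminal n h ha hs
      · exact hcont n h ha hs
    · simp [indicator_of_notMem ha]
  have hsum : ∀ n, (∑ k ∈ Finset.range n,
      ∫⁻ ω, M.stageCost p x k (p.history ω k) ∂(M.bayesLaw x)) + M.residualCost p x w n ≤ w x := by
    intro n
    induction n with
    | zero => simp [M.residualCost_zero p hx w]
    | succ n ih =>
      rw [Finset.sum_range_succ, add_assoc]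
      exact le_trans (by gcongr; exact hstep n) ih
  -- The remainder is nonnegative and can be dropped, so this direction needs neither a bound on `w`
  -- nor termination of `p`.
  rw [M.risk_eq_tsum p hx]
  exact ENNReal.tsum_le_of_sum_range_le fun n => le_self_add.trans (hsum n)

end SensorTestProblem

/-! ### Measurable selection and feedback procedures -/

/-- A measurable selection of a minimizing index. -/
theorem exists_measurable_argmin {ι α β : Type*} [Fintype ι] [Nonempty ι] [MeasurableSpace ι]
    [MeasurableSpace α] [LinearOrder β] [TopologicalSpace β] [OrderClosedTopology β]
    [SecondCountableTopology β] [MeasurableSpace β] [BorelSpace β] {G : ι → α → β}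
    (hG : ∀ i, Measurable (G i)) :
    ∃ ψ : α → ι, Measurable ψ ∧ ∀ a i, G (ψ a) a ≤ G i a := by
  classical
  -- The induction over finite subsets carries along the measurability of the minimal value, which
  -- the comparison with a new index requires.
  suffices h : ∀ s : Finset ι, s.Nonempty → ∃ ψ : α → ι, Measurable ψ ∧
      Measurable (fun a => G (ψ a) a) ∧ ∀ a, ∀ i ∈ s, G (ψ a) a ≤ G i a by
    obtain ⟨ψ, h1, -, h2⟩ := h Finset.univ Finset.univ_nonempty
    exact ⟨ψ, h1, fun a i => h2 a i (Finset.mem_univ i)⟩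
  intro s hs
  induction hs using Finset.Nonempty.cons_induction with
  | singleton i => exact ⟨fun _ => i, measurable_const, hG i, by simp⟩
  | cons i s hi hs ih =>
    obtain ⟨ψ, h1, h2, h3⟩ := ih
    have hS : MeasurableSet {a | G i a ≤ G (ψ a) a} := measurableSet_le (hG i) h2
    refine ⟨fun a => if G i a ≤ G (ψ a) a then i else ψ a,
      Measurable.ite hS measurable_const h1, ?_, fun a j hj => ?_⟩
    · have e : (fun a => G (if G i a ≤ G (ψ a) a then i else ψ a) a) =
          fun a => if G i a ≤ G (ψ a) a then G i a else G (ψ a) a := by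
        funext a
        split_ifs <;> rfl
      rw [e]
      exact Measurable.ite hS (hG i) h2
    · rcases Finset.mem_cons.1 hj with rfl | hj
      · dsimp only
        split_ifs with h
        · exact le_rfl
        · exact (not_le.1 h).le
      · dsimp only
        split_ifs with h
        · exact h.trans (h3 a j hj)
        · exact h3 a j hj

namespace SequentialProcedure

variable {K : ℕ} {X S : Type*} [MeasurableSpace X] [MeasurableSpace S]

/-- The state after the history `h` of a system whose control is a function of its state. -/
def feedbackState (s₀ : S) (step : Fin K → S → X → S) (ψ : S → Fin K) :
    (n : ℕ) → (Fin n → X) → S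
  | 0, _ => s₀
  | n + 1, h => step (ψ (feedbackState s₀ step ψ n (Fin.init h)))
      (feedbackState s₀ step ψ n (Fin.init h)) (h (Fin.last n))

theorem measurable_feedbackState {s₀ : S} {step : Fin K → S → X → S} {ψ : S → Fin K}
    (hstep : ∀ ℓ, Measurable fun q : S × X => step ℓ q.1 q.2) (hψ : Measurable ψ) (n : ℕ) :
    Measurable (feedbackState s₀ step ψ n : (Fin n → X) → S) := by
  induction n with
  | zero => exact measurable_const
  | succ n ih =>
    have h : Measurable fun q : (S × X) × Fin K => step q.2 q.1.1 q.1.2 :=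
      measurable_from_prod_countable_left hstep
    have hi := ih.comp (measurable_init (X := X))
    exact h.comp ((hi.prodMk (measurable_pi_apply _)).prodMk (hψ.comp hi))

/-- The procedure whose actions are functions of a recursively updated state. -/
def feedback (s₀ : S) (step : Fin K → S → X → S) (ψ : S → Fin K) (halt : Set S) (d : S → Fin 2)
    (hstep : ∀ ℓ, Measurable fun q : S × X => step ℓ q.1 q.2) (hψ : Measurable ψ)
    (hterminal : MeasurableSet halt) (hd : Measurable d) : SequentialProcedure K X where
  select n h := ψ (feedbackState s₀ step ψ n h)
  measurable_select n := hψ.comp (measurable_feedbackState hstep hψ n)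
  stopSet n := feedbackState s₀ step ψ n ⁻¹' halt
  measurableSet_stopSet n := measurable_feedbackState hstep hψ n hterminal
  decide n h := d (feedbackState s₀ step ψ n h)
  measurable_decide n := hd.comp (measurable_feedbackState hstep hψ n)

end SequentialProcedure

/-! ### Value iteration and its limit -/

namespace SensorTestProblem

variable {K : ℕ} {X : Type*} [MeasurableSpace X] (M : SensorTestProblem K X)

theorem stopCost_nonneg {x : ℝ} (hx : x ∈ Icc (0 : ℝ) 1) : 0 ≤ M.stopCost x :=
  le_min (mul_nonneg (NNReal.coe_nonneg _) hx.1)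
    (mul_nonneg (NNReal.coe_nonneg _) (by linarith [hx.2]))

theorem stopCost_le {x : ℝ} (hx : x ∈ Icc (0 : ℝ) 1) : M.stopCost x ≤ M.μ₀ := by
  refine (min_le_right _ _).trans ?_
  nlinarith [hx.1, NNReal.coe_nonneg M.μ₀]

theorem one_le_sampleCost (ℓ : Fin K) : 1 ≤ M.sampleCost ℓ := by
  rw [sampleCost]
  split_ifs <;> simp

theorem measurable_stopCost : Measurable M.stopCost := by
  unfold stopCost
  fun_prop

theorem mix_eq_lintegral_add (x : ℝ) (ℓ : Fin K) (g : X → ℝ≥0∞) :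
    M.mix x ℓ g = ∫⁻ y, g y
      ∂(ENNReal.ofReal (1 - x) • M.sampleLaw 0 ℓ + ENNReal.ofReal x • M.sampleLaw 1 ℓ) := by
  rw [mix, lintegral_add_measure, lintegral_smul_measure, lintegral_smul_measure, smul_eq_mul,
    smul_eq_mul]

theorem measurable_update_right (ℓ : Fin K) (x : ℝ) : Measurable (M.update ℓ x) :=
  (M.measurable_update ℓ).comp (measurable_const.prodMk measurable_id)

theorem measurable_sensorCostENNReal {w : ℝ → ℝ≥0∞} (hw : Measurable w) (ℓ : Fin K) :
    Measurable fun x => M.sensorCostENNReal w x ℓ := by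
  have h : Measurable fun q : ℝ × X => w (M.update ℓ q.1 q.2) := hw.comp (M.measurable_update ℓ)
  have h0 := M.measurable_lintegral_sampleLaw_const 0 ℓ h
  have h1 := M.measurable_lintegral_sampleLaw_const 1 ℓ h
  exact (((measurable_id.const_sub 1).ennreal_ofReal.mul h0).add
    (measurable_id.ennreal_ofReal.mul h1)).const_add _

/-- The Bellman operator on extended cost-to-go functions. -/
noncomputable def bellman (w : ℝ → ℝ≥0∞) (x : ℝ) : ℝ≥0∞ :=
  min (ENNReal.ofReal (M.stopCost x)) (⨅ ℓ, M.sensorCostENNReal w x ℓ)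

theorem sensorCostENNReal_mono {w w' : ℝ → ℝ≥0∞} (h : ∀ z, w z ≤ w' z) (x : ℝ) (ℓ : Fin K) :
    M.sensorCostENNReal w x ℓ ≤ M.sensorCostENNReal w' x ℓ :=
  add_le_add le_rfl (M.mix_mono ℓ fun _ => h _)

theorem bellman_mono {w w' : ℝ → ℝ≥0∞} (h : ∀ z, w z ≤ w' z) (x : ℝ) :
    M.bellman w x ≤ M.bellman w' x :=
  min_le_min le_rfl (iInf_mono fun ℓ => M.sensorCostENNReal_mono h x ℓ)

theorem measurable_bellman {w : ℝ → ℝ≥0∞} (hw : Measurable w) : Measurable (M.bellman w) :=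
  M.measurable_stopCost.ennreal_ofReal.min
    (Measurable.iInf fun ℓ => M.measurable_sensorCostENNReal hw ℓ)

/-- Value iteration, started with the cost of stopping. -/
noncomputable def valueIter : ℕ → ℝ → ℝ≥0∞
  | 0 => fun x => ENNReal.ofReal (M.stopCost x)
  | n + 1 => M.bellman (valueIter n)

theorem measurable_valueIter (n : ℕ) : Measurable (M.valueIter n) := by
  induction n with
  | zero => exact M.measurable_stopCost.ennreal_ofReal
  | succ n ih => exact M.measurable_bellman ih

theorem antitone_valueIter : Antitone M.valueIter := by
  refine antitone_nat_of_succ_le fun n => ?_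
  induction n with
  | zero => exact fun x => min_le_left _ _
  | succ n ih => exact fun x => M.bellman_mono ih x

/-- The limit of the value iteration. -/
noncomputable def valueLimit (x : ℝ) : ℝ≥0∞ := ⨅ n, M.valueIter n x

theorem measurable_valueLimit : Measurable M.valueLimit := Measurable.iInf M.measurable_valueIter

theorem valueLimit_le (x : ℝ) : M.valueLimit x ≤ ENNReal.ofReal (M.stopCost x) := iInf_le _ 0

/-- Monotone convergence for a decreasing sequence; the required finiteness holds for the initial
term, as `φ ≤ μ₀` on [0, 1]. -/
theorem sensorCostENNReal_valueLimit {x : ℝ} (hx : x ∈ Icc (0 : ℝ) 1) (ℓ : Fin K) :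
    M.sensorCostENNReal M.valueLimit x ℓ = ⨅ n, M.sensorCostENNReal (M.valueIter n) x ℓ := by
  simp only [sensorCostENNReal, mix_eq_lintegral_add, valueLimit]
  rw [lintegral_iInf, ENNReal.add_iInf]
  · exact fun n => (M.measurable_valueIter n).comp (M.measurable_update_right ℓ x)
  · exact fun m n hmn y => M.antitone_valueIter hmn _
  · rw [← mix_eq_lintegral_add]
    have h : M.mix x ℓ (fun y => M.valueIter 0 (M.update ℓ x y)) ≤ M.mix x ℓ fun _ => M.μ₀ := by
      refine M.mix_mono ℓ fun y => ?_
      rw [← ENNReal.ofReal_coe_nnreal]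
      exact ENNReal.ofReal_le_ofReal (M.stopCost_le (M.update_mem_Icc ℓ hx y))
    refine ne_top_of_le_ne_top ?_ h
    simp only [mix, lintegral_const, measure_univ, mul_one]
    finiteness

/-- The limit is itself an infimum over `n`, so it commutes with the minimum over the sensors and
with the minimum against `φ`. -/
theorem valueLimit_eq_bellman {x : ℝ} (hx : x ∈ Icc (0 : ℝ) 1) :
    M.valueLimit x = M.bellman M.valueLimit x := by
  have h1 : M.valueLimit x = ⨅ n, M.valueIter (n + 1) x := by
    refine le_antisymm (le_iInf fun n => iInf_le _ (n + 1)) (le_iInf fun n => ?_)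
    exact (iInf_le _ n).trans (M.antitone_valueIter n.le_succ x)
  rw [h1, bellman]
  simp_rw [M.sensorCostENNReal_valueLimit hx]
  rw [iInf_comm]
  exact inf_iInf.symm

/-- The procedure that follows the Bellman equation along the posterior probability. -/
theorem exists_risk_le [NeZero K] {w : ℝ → ℝ≥0∞} (hw : Measurable w)
    (hfix : ∀ z ∈ Icc (0 : ℝ) 1, w z = M.bellman w z) {x : ℝ} (hx : x ∈ Icc (0 : ℝ) 1) :
    ∃ p : SequentialProcedure K X, M.risk x p ≤ w x := by
  classical
  obtain ⟨ψ, hψm, hψ⟩ := exists_measurable_argmin fun ℓ => M.measurable_sensorCostENNReal hw ℓ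
  have hterminal : MeasurableSet {z | ENNReal.ofReal (M.stopCost z) ≤ w z} :=
    measurableSet_le M.measurable_stopCost.ennreal_ofReal hw
  have hd : Measurable fun z : ℝ => if M.μ₁ * z ≤ M.μ₀ * (1 - z) then (0 : Fin 2) else 1 :=
    Measurable.ite (measurableSet_le (by fun_prop) (by fun_prop)) measurable_const measurable_const
  let p := SequentialProcedure.feedback x M.update ψ _ _ M.measurable_update hψm hterminal hd
  -- The state of the feedback procedure is updated by Bayes' rule from the prior, hence is its own
  -- posterior.
  have hpost : ∀ n (h : Fin n → X), p.posterior M x n h =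
      SequentialProcedure.feedbackState x M.update ψ n h := by
    intro n
    induction n with
    | zero => exact fun h => rfl
    | succ n ih =>
      intro h
      simp only [SequentialProcedure.posterior, SequentialProcedure.feedbackState, ih]
      rfl
  refine ⟨p, M.risk_le hx hw p ?_ ?_⟩
  · intro n h _ hs
    have hz := p.posterior_mem_Icc M hx n h
    have hs' : ENNReal.ofReal (M.stopCost (p.posterior M x n h)) ≤ w (p.posterior M x n h) := by
      rw [hpost]
      exact hs
    refine le_trans ?_ hs'
    change M.decisionCost (if _ then _ else _) _ ≤ _
    rw [← hpost]
    generalize p.posterior M x n h = z at *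
    have hz' : 0 ≤ 1 - z := by linarith [hz.2]
    rw [decisionCost, stopCost]
    split_ifs with h1 h2 h2
    · simp at h2
    · rw [min_eq_left h1, ENNReal.ofReal_mul (NNReal.coe_nonneg _), ENNReal.ofReal_coe_nnreal]
    · rw [min_eq_right (not_le.1 h1).le, ENNReal.ofReal_mul (NNReal.coe_nonneg _),
        ENNReal.ofReal_coe_nnreal]
    · simp at h2
  · intro n h _ hs
    have hz := p.posterior_mem_Icc M hx n h
    have hs' : w (p.posterior M x n h) < ENNReal.ofReal (M.stopCost (p.posterior M x n h)) := by
      rw [hpost]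
      exact not_le.1 hs
    have hsel : p.select n h = ψ (p.posterior M x n h) := by
      rw [hpost]
      rfl
    rw [hsel]
    generalize p.posterior M x n h = z at *
    rw [hfix z hz, bellman] at hs' ⊢
    rw [min_lt_iff, or_iff_right (lt_irrefl _)] at hs'
    rw [min_eq_right hs'.le]
    exact le_iInf fun ℓ => hψ z ℓ

/-- The two verification bounds meet. A fixed point lies below `φ`, hence is bounded by `μ₀` on [0,
1]. Applied to the limit of value iteration this identifies the optimal cost; applied to an
arbitrary solution it gives uniqueness. -/
theorem eq_iInf_risk [NeZero K] {w : ℝ → ℝ≥0∞} (hw : Measurable w)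
    (hfix : ∀ z ∈ Icc (0 : ℝ) 1, w z = M.bellman w z) {x : ℝ} (hx : x ∈ Icc (0 : ℝ) 1) :
    w x = ⨅ p : SequentialProcedure K X, M.risk x p := by
  have hle : ∀ z ∈ Icc (0 : ℝ) 1, w z ≤ ENNReal.ofReal (M.stopCost z) := fun z hz => by
    rw [hfix z hz]
    exact min_le_left _ _
  refine le_antisymm (le_iInf fun p => M.le_risk hx hw (c := M.μ₀) ENNReal.coe_ne_top
    (fun z hz => ?_) hle (fun z hz ℓ => ?_) p) ?_
  · refine (hle z hz).trans ?_
    rw [← ENNReal.ofReal_coe_nnreal]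
    exact ENNReal.ofReal_le_ofReal (M.stopCost_le hz)
  · nth_rewrite 1 [hfix z hz]
    exact (min_le_right _ _).trans (iInf_le _ ℓ)
  · obtain ⟨p, hp⟩ := M.exists_risk_le hw hfix hx
    exact (iInf_le _ p).trans hp

/-! ### The real-valued Bellman equation and uniqueness -/

theorem integrable_comp_update {V : ℝ → ℝ} (hV : Measurable V) {c : ℝ}
    (hc : ∀ z ∈ Icc (0 : ℝ) 1, |V z| ≤ c) {x : ℝ} (hx : x ∈ Icc (0 : ℝ) 1) (i : Fin 2) (ℓ : Fin K) :
    Integrable (fun y => V (M.update ℓ x y)) (M.sampleLaw i ℓ) :=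
  Integrable.of_bound (hV.comp (M.measurable_update_right ℓ x)).aestronglyMeasurable c
    (.of_forall fun y => hc _ (M.update_mem_Icc ℓ hx y))

theorem add_le_sensorCost {V : ℝ → ℝ} (hV : Measurable V) {c m : ℝ}
    (hc : ∀ z ∈ Icc (0 : ℝ) 1, |V z| ≤ c) (hm : ∀ z ∈ Icc (0 : ℝ) 1, m ≤ V z) {x : ℝ}
    (hx : x ∈ Icc (0 : ℝ) 1) (ℓ : Fin K) : 1 + m ≤ M.sensorCost V x ℓ := by
  have h : ∀ i, m ≤ ∫ y, V (M.update ℓ x y) ∂(M.sampleLaw i ℓ) := fun i => by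
    have := integral_mono (integrable_const m) (M.integrable_comp_update hV hc hx i ℓ)
      fun y => hm _ (M.update_mem_Icc ℓ hx y)
    simpa using this
  have h0 := mul_le_mul_of_nonneg_left (h 0) (sub_nonneg.2 hx.2)
  have h1 := mul_le_mul_of_nonneg_left (h 1) hx.1
  rw [sensorCost]
  linarith [M.one_le_sampleCost ℓ]

theorem ofReal_sensorCost {V : ℝ → ℝ} (hV : Measurable V) {c : ℝ}
    (hc : ∀ z ∈ Icc (0 : ℝ) 1, |V z| ≤ c) (h0 : ∀ z ∈ Icc (0 : ℝ) 1, 0 ≤ V z) {x : ℝ}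
    (hx : x ∈ Icc (0 : ℝ) 1) (ℓ : Fin K) :
    ENNReal.ofReal (M.sensorCost V x ℓ) =
      M.sensorCostENNReal (fun z => ENNReal.ofReal (V z)) x ℓ := by
  have hn : ∀ i, 0 ≤ ∫ y, V (M.update ℓ x y) ∂(M.sampleLaw i ℓ) := fun i =>
    integral_nonneg fun y => h0 _ (M.update_mem_Icc ℓ hx y)
  have hx0 : 0 ≤ 1 - x := sub_nonneg.2 hx.2
  have hi : ∀ i, ENNReal.ofReal (∫ y, V (M.update ℓ x y) ∂(M.sampleLaw i ℓ)) =
      ∫⁻ y, ENNReal.ofReal (V (M.update ℓ x y)) ∂(M.sampleLaw i ℓ) := fun i =>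
    ofReal_integral_eq_lintegral_ofReal (M.integrable_comp_update hV hc hx i ℓ)
      (.of_forall fun y => h0 _ (M.update_mem_Icc ℓ hx y))
  rw [sensorCost, sensorCostENNReal, mix, ← hi, ← hi,
    ENNReal.ofReal_add (zero_le_one.trans (M.one_le_sampleCost ℓ))
      (add_nonneg (mul_nonneg hx0 (hn 0)) (mul_nonneg hx.1 (hn 1))),
    ENNReal.ofReal_add (mul_nonneg hx0 (hn 0)) (mul_nonneg hx.1 (hn 1)),
    ENNReal.ofReal_mul hx0, ENNReal.ofReal_mul hx.1]

theorem ofReal_continueCost [NeZero K] (V : ℝ → ℝ) (x : ℝ) :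
    ENNReal.ofReal (M.continueCost V x) = ⨅ ℓ, ENNReal.ofReal (M.sensorCost V x ℓ) := by
  obtain ⟨ℓ, hℓ⟩ := exists_eq_ciInf_of_finite (f := fun ℓ => M.sensorCost V x ℓ)
  have hℓ' : M.sensorCost V x ℓ = M.continueCost V x := hℓ
  refine le_antisymm (le_iInf fun k => ENNReal.ofReal_le_ofReal (ciInf_le (finite_range _).bddBelow k))
    ((iInf_le _ ℓ).trans_eq (by rw [hℓ']))

theorem one_le_continueCost [NeZero K] {V : ℝ → ℝ} (hV : Measurable V) {c : ℝ}
    (hc : ∀ z ∈ Icc (0 : ℝ) 1, |V z| ≤ c) (h0 : ∀ z ∈ Icc (0 : ℝ) 1, 0 ≤ V z) {x : ℝ}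
    (hx : x ∈ Icc (0 : ℝ) 1) : 1 ≤ M.continueCost V x :=
  le_ciInf fun ℓ => by linarith [M.add_le_sensorCost hV hc h0 hx ℓ]

theorem ofReal_min_stopCost_continueCost [NeZero K] {V : ℝ → ℝ} (hV : Measurable V) {c : ℝ}
    (hc : ∀ z ∈ Icc (0 : ℝ) 1, |V z| ≤ c) (h0 : ∀ z ∈ Icc (0 : ℝ) 1, 0 ≤ V z) {x : ℝ}
    (hx : x ∈ Icc (0 : ℝ) 1) :
    ENNReal.ofReal (min (M.stopCost x) (M.continueCost V x)) =
      M.bellman (fun z => ENNReal.ofReal (V z)) x := by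
  rw [bellman, ENNReal.ofReal_min, M.ofReal_continueCost]
  simp_rw [M.ofReal_sensorCost hV hc h0 hx]

/-- Each use of the equation raises a negative lower bound by the cost of a sample, at least 1: from
`-c` to `n - c` after `n` uses, until 0 is reached. This makes the extended nonnegative formulation
available to any bounded solution. -/
theorem SolvesBellman.nonneg [NeZero K] {M : SensorTestProblem K X} {V : ℝ → ℝ} (hV : Measurable V)
    {c : ℝ} (hc : ∀ z ∈ Icc (0 : ℝ) 1, |V z| ≤ c) (h : M.SolvesBellman V) :
    ∀ x ∈ Icc (0 : ℝ) 1, 0 ≤ V x := by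
  have hn : ∀ n : ℕ, ∀ x ∈ Icc (0 : ℝ) 1, min 0 (n - c) ≤ V x := by
    intro n
    induction n with
    | zero => exact fun x hx => (min_le_right _ _).trans (by simpa using (abs_le.1 (hc x hx)).1)
    | succ n ih =>
      intro x hx
      rw [h x hx]
      refine le_min ((min_le_left _ _).trans (M.stopCost_nonneg hx)) (le_ciInf fun ℓ => ?_)
      refine le_trans ?_ (M.add_le_sensorCost hV hc ih hx ℓ)
      rcases min_cases (0 : ℝ) (n - c) with h1 | h1
      · rw [h1.1]
        exact (min_le_left _ _).trans (by norm_num)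
      · rw [h1.1]
        refine (min_le_right _ _).trans (le_of_eq ?_)
        push_cast
        ring
  intro x hx
  obtain ⟨n, hcn⟩ := exists_nat_ge c
  simpa [sub_nonneg.2 hcn] using hn n x hx

theorem valueLimit_ne_top (x : ℝ) : M.valueLimit x ≠ ⊤ :=
  ne_top_of_le_ne_top ENNReal.ofReal_ne_top (M.valueLimit_le x)

theorem valueLimit_toReal_nonneg (x : ℝ) : 0 ≤ (M.valueLimit x).toReal := ENNReal.toReal_nonneg

theorem abs_valueLimit_toReal_le : ∀ x ∈ Icc (0 : ℝ) 1, |(M.valueLimit x).toReal| ≤ M.μ₀ := by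
  intro x hx
  rw [abs_of_nonneg ENNReal.toReal_nonneg]
  refine (ENNReal.toReal_mono ENNReal.ofReal_ne_top (M.valueLimit_le x)).trans ?_
  rw [ENNReal.toReal_ofReal (M.stopCost_nonneg hx)]
  exact M.stopCost_le hx

theorem solvesBellman_valueLimit [NeZero K] : M.SolvesBellman fun x => (M.valueLimit x).toReal := by
  intro x hx
  have hV := M.measurable_valueLimit.ennreal_toReal
  have h := M.ofReal_min_stopCost_continueCost hV M.abs_valueLimit_toReal_le
    (fun z _ => M.valueLimit_toReal_nonneg z) hx
  simp_rw [ENNReal.ofReal_toReal (M.valueLimit_ne_top _)] at h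
  rw [← M.valueLimit_eq_bellman hx] at h
  change (M.valueLimit x).toReal = _
  rw [← h, ENNReal.toReal_ofReal]
  exact le_min (M.stopCost_nonneg hx) (zero_le_one.trans (M.one_le_continueCost hV
    M.abs_valueLimit_toReal_le (fun z _ => M.valueLimit_toReal_nonneg z) hx))

theorem iInf_risk_eq_valueLimit [NeZero K] {x : ℝ} (hx : x ∈ Icc (0 : ℝ) 1) :
    ⨅ p : SequentialProcedure K X, M.risk x p = M.valueLimit x :=
  (M.eq_iInf_risk M.measurable_valueLimit (fun _ hz => M.valueLimit_eq_bellman hz) hx).symm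

theorem eqOn_optCost [NeZero K] :
    EqOn M.optCost (fun x => (M.valueLimit x).toReal) (Icc 0 1) := fun x hx => by
  rw [optCost, M.iInf_risk_eq_valueLimit hx]

theorem SolvesBellman.eqOn_optCost [NeZero K] {M : SensorTestProblem K X} {V : ℝ → ℝ}
    (hV : Measurable V) {c : ℝ} (hc : ∀ z ∈ Icc (0 : ℝ) 1, |V z| ≤ c) (h : M.SolvesBellman V) :
    EqOn V M.optCost (Icc 0 1) := by
  intro x hx
  have h0 := h.nonneg hV hc
  have hfix : ∀ z ∈ Icc (0 : ℝ) 1,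
      ENNReal.ofReal (V z) = M.bellman (fun z => ENNReal.ofReal (V z)) z := fun z hz => by
    rw [← M.ofReal_min_stopCost_continueCost hV hc h0 hz, ← h z hz]
  rw [optCost, ← M.eq_iInf_risk hV.ennreal_ofReal hfix hx, ENNReal.toReal_ofReal (h0 x hx)]

/-- Posteriors stay in [0, 1]. This allows `optCost`, uncontrolled outside that interval, to be
exchanged for the measurable `valueLimit`. -/
theorem sensorCost_congr {V W : ℝ → ℝ} (h : EqOn V W (Icc 0 1)) {x : ℝ} (hx : x ∈ Icc (0 : ℝ) 1)
    (ℓ : Fin K) : M.sensorCost V x ℓ = M.sensorCost W x ℓ := by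
  simp only [sensorCost, h (M.update_mem_Icc ℓ hx _)]

theorem continueCost_congr {V W : ℝ → ℝ} (h : EqOn V W (Icc 0 1)) {x : ℝ}
    (hx : x ∈ Icc (0 : ℝ) 1) : M.continueCost V x = M.continueCost W x := by
  simp only [continueCost, M.sensorCost_congr h hx]

theorem solvesBellman_optCost [NeZero K] : M.SolvesBellman M.optCost := fun x hx => by
  rw [M.continueCost_congr M.eqOn_optCost hx, M.eqOn_optCost hx]
  exact M.solvesBellman_valueLimit x hx

/-! ### The finite-horizon limit and concavity of the optimal cost -/

/-- Truncating a procedure of finite risk costs little. -/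
theorem tendsto_finiteOptCost [NeZero K] {x : ℝ} (hx : x ∈ Icc (0 : ℝ) 1) :
    Tendsto (fun N => M.finiteOptCost N x) atTop (𝓝 (M.optCost x)) := by
  obtain ⟨p, hp⟩ := M.exists_risk_le M.measurable_valueLimit
    (fun _ hz => M.valueLimit_eq_bellman hz) hx
  have hfin : M.risk x p ≠ ⊤ := ne_top_of_le_ne_top (M.valueLimit_ne_top x) hp
  have hV := M.iInf_risk_eq_valueLimit hx
  rw [optCost]
  refine (ENNReal.tendsto_toReal (by rw [hV]; exact M.valueLimit_ne_top x)).comp ?_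
  have hlim : Tendsto (fun N => M.risk x p + (M.μ₀ + M.μ₁) * M.aliveProb p x N) atTop
      (𝓝 (M.risk x p + (M.μ₀ + M.μ₁) * 0)) :=
    (ENNReal.Tendsto.const_mul (M.tendsto_aliveProb hfin) (Or.inr (by finiteness))).const_add _
  -- Since `p` is optimal, the limit of the upper bounds is the infimum itself.
  rw [mul_zero, add_zero, le_antisymm (hp.trans_eq hV.symm) (iInf_le _ p)] at hlim
  refine tendsto_of_tendsto_of_tendsto_of_le_of_le tendsto_const_nhds hlim (fun N => ?_)
    fun N => ?_
  · exact le_iInf₂ fun q _ => iInf_le _ q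
  · refine (iInf₂_le (p.truncate N) (p.stopTime_truncate_le N)).trans ?_
    rw [← le_antisymm (hp.trans_eq hV.symm) (iInf_le _ p)]
    exact M.risk_truncate_le p x N

/-- A procedure does not know the prior, which enters its risk only through the weights `1 - x` and
`x`. The optimal cost is thus an infimum of affine functions. -/
theorem risk_combo (p : SequentialProcedure K X) {x y a b : ℝ} (hx : x ∈ Icc (0 : ℝ) 1)
    (hy : y ∈ Icc (0 : ℝ) 1) (ha : 0 ≤ a) (hb : 0 ≤ b) (hab : a + b = 1) :
    M.risk (a * x + b * y) p = ENNReal.ofReal a * M.risk x p + ENNReal.ofReal b * M.risk y p := by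
  have h1 : ENNReal.ofReal (a * x + b * y) =
      ENNReal.ofReal a * ENNReal.ofReal x + ENNReal.ofReal b * ENNReal.ofReal y := by
    rw [ENNReal.ofReal_add (mul_nonneg ha hx.1) (mul_nonneg hb hy.1), ENNReal.ofReal_mul ha,
      ENNReal.ofReal_mul hb]
  have h0 : ENNReal.ofReal (1 - (a * x + b * y)) =
      ENNReal.ofReal a * ENNReal.ofReal (1 - x) + ENNReal.ofReal b * ENNReal.ofReal (1 - y) := by
    have : 1 - (a * x + b * y) = a * (1 - x) + b * (1 - y) := by linear_combination -hab
    rw [this, ENNReal.ofReal_add (mul_nonneg ha (sub_nonneg.2 hx.2))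
      (mul_nonneg hb (sub_nonneg.2 hy.2)), ENNReal.ofReal_mul ha, ENNReal.ofReal_mul hb]
  have he : ∀ g, M.expect (a * x + b * y) g =
      ENNReal.ofReal a * M.expect x g + ENNReal.ofReal b * M.expect y g := fun g => by
    simp only [expect, h0, h1]
    ring
  have hs : ∑ ℓ ∈ M.constrained, M.lam ℓ * M.expect (a * x + b * y) (p.usage ℓ) =
      ENNReal.ofReal a * ∑ ℓ ∈ M.constrained, M.lam ℓ * M.expect x (p.usage ℓ) +
        ENNReal.ofReal b * ∑ ℓ ∈ M.constrained, M.lam ℓ * M.expect y (p.usage ℓ) := by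
    rw [Finset.mul_sum, Finset.mul_sum, ← Finset.sum_add_distrib]
    refine Finset.sum_congr rfl fun ℓ _ => ?_
    rw [he]
    ring
  rw [risk, hs, he, h0, h1, risk, risk]
  ring

theorem concaveOn_optCost [NeZero K] : ConcaveOn ℝ (Icc 0 1) M.optCost := by
  refine ⟨convex_Icc 0 1, fun x hx y hy a b ha hb hab => ?_⟩
  have hz : a * x + b * y ∈ Icc (0 : ℝ) 1 := convex_Icc 0 1 hx hy ha hb hab
  rw [smul_eq_mul, smul_eq_mul, smul_eq_mul, smul_eq_mul, M.eqOn_optCost hx, M.eqOn_optCost hy,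
    M.eqOn_optCost hz]
  have h : ENNReal.ofReal a * M.valueLimit x + ENNReal.ofReal b * M.valueLimit y ≤
      M.valueLimit (a * x + b * y) := by
    rw [← M.iInf_risk_eq_valueLimit hx, ← M.iInf_risk_eq_valueLimit hy,
      ← M.iInf_risk_eq_valueLimit hz]
    refine le_iInf fun p => ?_
    rw [M.risk_combo p hx hy ha hb hab]
    gcongr <;> exact iInf_le _ p
  have h' := ENNReal.toReal_mono (M.valueLimit_ne_top _) h
  have hx' := M.valueLimit_ne_top x
  have hy' := M.valueLimit_ne_top y
  rwa [ENNReal.toReal_add (by finiteness) (by finiteness), ENNReal.toReal_mul, ENNReal.toReal_mul,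
    ENNReal.toReal_ofReal ha, ENNReal.toReal_ofReal hb] at h'

end SensorTestProblem

/-! ### Concavity of the continuation cost -/

namespace SensorTestProblem

variable {K : ℕ} {X : Type*} [MeasurableSpace X] (M : SensorTestProblem K X)

/-- The perspective of a concave function of the posterior probability is concave. -/
theorem perspective_update {V : ℝ → ℝ} (hV : ConcaveOn ℝ (Icc 0 1) V) (ℓ : Fin K) (y : X)
    {x x' a b : ℝ} (hx : x ∈ Icc (0 : ℝ) 1) (hx' : x' ∈ Icc (0 : ℝ) 1) (ha : 0 ≤ a) (hb : 0 ≤ b)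
    (hab : a + b = 1) :
    a * (((1 - x) * M.density 0 ℓ y + x * M.density 1 ℓ y) * V (M.update ℓ x y)) +
        b * (((1 - x') * M.density 0 ℓ y + x' * M.density 1 ℓ y) * V (M.update ℓ x' y)) ≤
      ((1 - (a * x + b * x')) * M.density 0 ℓ y + (a * x + b * x') * M.density 1 ℓ y) *
        V (M.update ℓ (a * x + b * x') y) := by
  have hm := M.update_mem_Icc ℓ hx y
  have hm' := M.update_mem_Icc ℓ hx' y
  -- Both the mixture density and its product with the updated posterior are affine in `t`; this is
  -- what makes the perspective argument work.
  have key : ∀ t ∈ Icc (0 : ℝ) 1,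
      ((1 - t) * M.density 0 ℓ y + t * M.density 1 ℓ y) * M.update ℓ t y =
        t * M.density 1 ℓ y := by
    intro t ht
    have h0 : 0 ≤ (1 - t) * M.density 0 ℓ y :=
      mul_nonneg (sub_nonneg.2 ht.2) (NNReal.coe_nonneg _)
    have h1 : 0 ≤ t * M.density 1 ℓ y := mul_nonneg ht.1 (NNReal.coe_nonneg _)
    rw [update]
    rcases eq_or_ne ((1 - t) * M.density 0 ℓ y + t * M.density 1 ℓ y : ℝ) 0 with h | h
    · rw [h, zero_mul]
      linarith
    · field_simp
  have hp : ∀ t ∈ Icc (0 : ℝ) 1, 0 ≤ (1 - t) * M.density 0 ℓ y + t * M.density 1 ℓ y := by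
    intro t ht
    exact add_nonneg (mul_nonneg (sub_nonneg.2 ht.2) (NNReal.coe_nonneg _))
      (mul_nonneg ht.1 (NNReal.coe_nonneg _))
  have hz : a * x + b * x' ∈ Icc (0 : ℝ) 1 := convex_Icc 0 1 hx hx' ha hb hab
  have kx := key x hx
  have kx' := key x' hx'
  have px := hp x hx
  have px' := hp x' hx'
  have pz := hp _ hz
  have hsum : (1 - (a * x + b * x')) * M.density 0 ℓ y + (a * x + b * x') * M.density 1 ℓ y =
      a * ((1 - x) * M.density 0 ℓ y + x * M.density 1 ℓ y) +
        b * ((1 - x') * M.density 0 ℓ y + x' * M.density 1 ℓ y) := by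
    linear_combination (-(M.density 0 ℓ y : ℝ)) * hab
  have hlin : (a * x + b * x') * (M.density 1 ℓ y : ℝ) =
      a * (x * M.density 1 ℓ y) + b * (x' * M.density 1 ℓ y) := by ring
  have kz := (key _ hz).trans hlin
  rw [← kx, ← kx'] at kz
  generalize (1 - x) * (M.density 0 ℓ y : ℝ) + x * M.density 1 ℓ y = p at *
  generalize (1 - x') * (M.density 0 ℓ y : ℝ) + x' * M.density 1 ℓ y = p' at *
  generalize (1 - (a * x + b * x')) * (M.density 0 ℓ y : ℝ) +
    (a * x + b * x') * M.density 1 ℓ y = q at *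
  generalize M.update ℓ x y = u at *
  generalize M.update ℓ x' y = u' at *
  generalize M.update ℓ (a * x + b * x') y = v at *
  rcases pz.eq_or_lt with h | h
  -- Zero mixture density at the intermediate prior forces both weights on the left to vanish.
  · have h1 : a * p = 0 := by nlinarith [mul_nonneg ha px, mul_nonneg hb px']
    have h2 : b * p' = 0 := by nlinarith [mul_nonneg ha px, mul_nonneg hb px']
    rw [← h, ← mul_assoc, ← mul_assoc, h1, h2]
    simp
  · have hα : 0 ≤ a * p / q := by positivity
    have hβ : 0 ≤ b * p' / q := by positivity
    have hαβ : a * p / q + b * p' / q = 1 := by rw [← add_div, ← hsum, div_self h.ne']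
    have hc := hV.2 hm hm' hα hβ hαβ
    simp only [smul_eq_mul] at hc
    have hv : a * p / q * u + b * p' / q * u' = v := by
      field_simp
      linarith
    rw [hv] at hc
    have := mul_le_mul_of_nonneg_left hc pz
    have e : q * (a * p / q * V u + b * p' / q * V u') = a * (p * V u) + b * (p' * V u') := by
      field_simp
    linarith

/-- Written over the reference measure, the integrand is a perspective of `V` for each fixed sample,
hence concave in the prior; integration preserves this. -/
theorem concaveOn_sensorCost {V : ℝ → ℝ} (hVm : Measurable V) {c : ℝ}
    (hc : ∀ z ∈ Icc (0 : ℝ) 1, |V z| ≤ c) (h0 : ∀ z ∈ Icc (0 : ℝ) 1, 0 ≤ V z)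
    (hV : ConcaveOn ℝ (Icc 0 1) V) (ℓ : Fin K) :
    ConcaveOn ℝ (Icc 0 1) fun x => M.sensorCost V x ℓ := by
  refine ⟨convex_Icc 0 1, fun x hx x' hx' a b ha hb hab => ?_⟩
  have hz : a * x + b * x' ∈ Icc (0 : ℝ) 1 := convex_Icc 0 1 hx hx' ha hb hab
  simp only [smul_eq_mul]
  have hnn : ∀ t ∈ Icc (0 : ℝ) 1, 0 ≤ M.sensorCost V t ℓ := fun t ht => by
    linarith [M.add_le_sensorCost hVm hc h0 ht ℓ]
  have hmeas : ∀ t, Measurable fun y =>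
      ((1 - t) * M.density 0 ℓ y + t * M.density 1 ℓ y) * V (M.update ℓ t y) := fun t =>
    (((M.measurable_density 0 ℓ).coe_nnreal_real.const_mul _).add
      ((M.measurable_density 1 ℓ).coe_nnreal_real.const_mul _)).mul
        (hVm.comp (M.measurable_update_right ℓ t))
  have hp : ∀ t ∈ Icc (0 : ℝ) 1, ∀ y, 0 ≤ (1 - t) * M.density 0 ℓ y + t * M.density 1 ℓ y := by
    intro t ht y
    exact add_nonneg (mul_nonneg (sub_nonneg.2 ht.2) (NNReal.coe_nonneg _))
      (mul_nonneg ht.1 (NNReal.coe_nonneg _))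
  have hrep : ∀ t ∈ Icc (0 : ℝ) 1, ENNReal.ofReal (M.sensorCost V t ℓ) =
      ENNReal.ofReal (M.sampleCost ℓ) + ∫⁻ y, ENNReal.ofReal
        (((1 - t) * M.density 0 ℓ y + t * M.density 1 ℓ y) * V (M.update ℓ t y)) ∂M.ref := by
    intro t ht
    have hm : Measurable fun y => ENNReal.ofReal (V (M.update ℓ t y)) :=
      (hVm.comp (M.measurable_update_right ℓ t)).ennreal_ofReal
    rw [M.ofReal_sensorCost hVm hc h0 ht, sensorCostENNReal, M.mix_eq_lintegral ht ℓ hm]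
    congr 1
    exact lintegral_congr fun y => (ENNReal.ofReal_mul (hp t ht y)).symm
  rw [← ENNReal.ofReal_le_ofReal_iff (hnn _ hz), ENNReal.ofReal_add (mul_nonneg ha (hnn x hx))
    (mul_nonneg hb (hnn x' hx')), ENNReal.ofReal_mul ha, ENNReal.ofReal_mul hb, hrep x hx,
    hrep x' hx', hrep _ hz, mul_add, mul_add, add_add_add_comm, ← add_mul,
    ← ENNReal.ofReal_add ha hb, hab, ENNReal.ofReal_one, one_mul]
  gcongr
  rw [← lintegral_const_mul _ (hmeas x).ennreal_ofReal,
    ← lintegral_const_mul _ (hmeas x').ennreal_ofReal,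
    ← lintegral_add_left ((hmeas x).ennreal_ofReal.const_mul _)]
  refine lintegral_mono fun y => ?_
  have h1 : ∀ t ∈ Icc (0 : ℝ) 1,
      0 ≤ ((1 - t) * M.density 0 ℓ y + t * M.density 1 ℓ y) * V (M.update ℓ t y) := fun t ht =>
    mul_nonneg (hp t ht y) (h0 _ (M.update_mem_Icc ℓ ht y))
  rw [← ENNReal.ofReal_mul ha, ← ENNReal.ofReal_mul hb,
    ← ENNReal.ofReal_add (mul_nonneg ha (h1 x hx)) (mul_nonneg hb (h1 x' hx'))]
  exact ENNReal.ofReal_le_ofReal (M.perspective_update hV ℓ y hx hx' ha hb hab)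

theorem concaveOn_continueCost [NeZero K] {V : ℝ → ℝ} (hVm : Measurable V) {c : ℝ}
    (hc : ∀ z ∈ Icc (0 : ℝ) 1, |V z| ≤ c) (h0 : ∀ z ∈ Icc (0 : ℝ) 1, 0 ≤ V z)
    (hV : ConcaveOn ℝ (Icc 0 1) V) : ConcaveOn ℝ (Icc 0 1) (M.continueCost V) := by
  refine ⟨convex_Icc 0 1, fun x hx x' hx' a b ha hb hab => le_ciInf fun ℓ => ?_⟩
  refine le_trans ?_ ((M.concaveOn_sensorCost hVm hc h0 hV ℓ).2 hx hx' ha hb hab)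
  have h : ∀ t, M.continueCost V t ≤ M.sensorCost V t ℓ := fun t =>
    ciInf_le (finite_range _).bddBelow ℓ
  simp only [smul_eq_mul]
  gcongr <;> exact h _

theorem concaveOn_valueLimit [NeZero K] :
    ConcaveOn ℝ (Icc 0 1) fun x => (M.valueLimit x).toReal :=
  M.concaveOn_optCost.congr M.eqOn_optCost

theorem concaveOn_continueCost_optCost [NeZero K] :
    ConcaveOn ℝ (Icc 0 1) (M.continueCost M.optCost) :=
  (M.concaveOn_continueCost M.measurable_valueLimit.ennreal_toReal M.abs_valueLimit_toReal_le
    (fun z _ => M.valueLimit_toReal_nonneg z) M.concaveOn_valueLimit).congr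
    fun _ hx => (M.continueCost_congr M.eqOn_optCost hx).symm

theorem one_le_continueCost_optCost [NeZero K] {x : ℝ} (hx : x ∈ Icc (0 : ℝ) 1) :
    1 ≤ M.continueCost M.optCost x := by
  rw [M.continueCost_congr M.eqOn_optCost hx]
  exact M.one_le_continueCost M.measurable_valueLimit.ennreal_toReal M.abs_valueLimit_toReal_le
    (fun z _ => M.valueLimit_toReal_nonneg z) hx

theorem ofReal_sensorCost_optCost [NeZero K] {x : ℝ} (hx : x ∈ Icc (0 : ℝ) 1) (ℓ : Fin K) :
    ENNReal.ofReal (M.sensorCost M.optCost x ℓ) = M.sensorCostENNReal M.valueLimit x ℓ := by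
  rw [M.sensorCost_congr M.eqOn_optCost hx, M.ofReal_sensorCost
    M.measurable_valueLimit.ennreal_toReal M.abs_valueLimit_toReal_le
    (fun z _ => M.valueLimit_toReal_nonneg z) hx]
  simp_rw [ENNReal.ofReal_toReal (M.valueLimit_ne_top _)]

theorem ofReal_optCost [NeZero K] {x : ℝ} (hx : x ∈ Icc (0 : ℝ) 1) :
    ENNReal.ofReal (M.optCost x) = M.valueLimit x := by
  rw [M.eqOn_optCost hx, ENNReal.ofReal_toReal (M.valueLimit_ne_top _)]

end SensorTestProblem

/-! ### Concave functions against lines, and the posterior as a function of `L` -/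

/-- If continuing is better than stopping at `x`, it is so at larger posteriors at which `H_0` is
still the better decision. -/
theorem ConcaveOn.lt_mul_of_le {C : ℝ → ℝ} (hC : ConcaveOn ℝ (Icc 0 1) C) (h0 : 0 < C 0)
    {m x z : ℝ} (hx : 0 ≤ x) (hxz : x ≤ z) (hz : z ≤ 1) (h : C x < m * x) : C z < m * z := by
  by_contra! hle
  rcases hx.eq_or_lt with rfl | hx
  · simp at h
    linarith
  have hz0 : 0 < z := hx.trans_le hxz
  have hmz : z ∈ Icc (0 : ℝ) 1 := ⟨hz0.le, hz⟩
  have hα : 0 ≤ x / z := by positivity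
  -- Here `x` is the convex combination of `z` and 0 with weight `x / z`. If `C z ≥ m * z`, the
  -- chord to the nonnegative value `C 0` lies above the line at `x`.
  have h1 := hC.2 hmz (left_mem_Icc.2 zero_le_one) hα
    (sub_nonneg.2 ((div_le_one hz0).2 hxz)) (add_sub_cancel (x / z) 1)
  simp only [smul_eq_mul, mul_zero, add_zero, div_mul_cancel₀ x hz0.ne'] at h1
  have h2 : 0 ≤ (1 - x / z) * C 0 :=
    mul_nonneg (sub_nonneg.2 ((div_le_one hz0).2 hxz)) h0.le
  have h3 : x / z * (m * z) ≤ x / z * C z := by gcongr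
  have h4 : x / z * (m * z) = m * x := by field_simp
  linarith

/-- The previous lemma under the reflection `t ↦ 1 - t`, which exchanges the hypotheses. -/
theorem ConcaveOn.lt_mul_one_sub_of_le {C : ℝ → ℝ} (hC : ConcaveOn ℝ (Icc 0 1) C) (h1 : 0 < C 1)
    {m x z : ℝ} (hx : x ≤ 1) (hxz : z ≤ x) (hz : 0 ≤ z) (h : C x < m * (1 - x)) :
    C z < m * (1 - z) := by
  have hC' : ConcaveOn ℝ (Icc 0 1) fun t => C (1 - t) := by
    refine ⟨convex_Icc 0 1, fun s hs t ht a b ha hb hab => ?_⟩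
    have hs' : 1 - s ∈ Icc (0 : ℝ) 1 := ⟨by linarith [hs.2], by linarith [hs.1]⟩
    have ht' : 1 - t ∈ Icc (0 : ℝ) 1 := ⟨by linarith [ht.2], by linarith [ht.1]⟩
    have := hC.2 hs' ht' ha hb hab
    simp only [smul_eq_mul] at this ⊢
    convert this using 2
    linear_combination -hab
  simpa using hC'.lt_mul_of_le (by simpa using h1) (m := m) (x := 1 - x) (z := 1 - z)
    (by linarith) (by linarith) (by linarith) (by simpa using h)

theorem posteriorOfLLR_zero (x : ℝ) : posteriorOfLLR x 0 = x := by
  simp [posteriorOfLLR]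

theorem posteriorOfLLR_mem_Icc {x : ℝ} (hx : x ∈ Icc (0 : ℝ) 1) (L : ℝ) :
    posteriorOfLLR x L ∈ Icc (0 : ℝ) 1 := by
  have h0 : 0 ≤ x * Real.exp L := mul_nonneg hx.1 (Real.exp_pos L).le
  have h1 : 0 ≤ 1 - x := sub_nonneg.2 hx.2
  exact ⟨div_nonneg h0 (by positivity), div_le_one_of_le₀ (by linarith) (by positivity)⟩

theorem posteriorOfLLR_mem_Ioo {x : ℝ} (hx : x ∈ Ioo (0 : ℝ) 1) (L : ℝ) :
    posteriorOfLLR x L ∈ Ioo (0 : ℝ) 1 := by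
  have h0 : 0 < x * Real.exp L := mul_pos hx.1 (Real.exp_pos L)
  have h1 : 0 < 1 - x := sub_pos.2 hx.2
  exact ⟨div_pos h0 (by positivity), (div_lt_one (by positivity)).2 (by linarith)⟩

theorem one_sub_posteriorOfLLR {x : ℝ} (hx : x ∈ Ioo (0 : ℝ) 1) (L : ℝ) :
    1 - posteriorOfLLR x L = (1 - x) / (1 - x + x * Real.exp L) := by
  have h0 : 0 < x * Real.exp L := mul_pos hx.1 (Real.exp_pos L)
  have h1 : 0 < 1 - x := sub_pos.2 hx.2
  rw [posteriorOfLLR]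
  field_simp
  ring

theorem monotone_posteriorOfLLR {x : ℝ} (hx : x ∈ Ioo (0 : ℝ) 1) : Monotone (posteriorOfLLR x) := by
  intro L L' h
  have h0 : 0 < x * Real.exp L := mul_pos hx.1 (Real.exp_pos L)
  have h1 : 0 < 1 - x := sub_pos.2 hx.2
  have h2 : 1 - posteriorOfLLR x L' ≤ 1 - posteriorOfLLR x L := by
    rw [one_sub_posteriorOfLLR hx, one_sub_posteriorOfLLR hx]
    have := hx.1.le
    gcongr
  linarith

theorem continuous_posteriorOfLLR {x : ℝ} (hx : x ∈ Ioo (0 : ℝ) 1) :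
    Continuous (posteriorOfLLR x) := by
  refine Continuous.div (by fun_prop) (by fun_prop) fun L => ?_
  have h0 : 0 < x * Real.exp L := mul_pos hx.1 (Real.exp_pos L)
  linarith [hx.2]

theorem measurable_posteriorOfLLR (x : ℝ) : Measurable (posteriorOfLLR x) := by
  unfold posteriorOfLLR
  fun_prop

theorem tendsto_posteriorOfLLR_atBot {x : ℝ} (hx : x ∈ Ioo (0 : ℝ) 1) :
    Tendsto (posteriorOfLLR x) atBot (𝓝 0) := by
  have h1 : (1 - x + x * 0 : ℝ) ≠ 0 := by linarith [hx.2]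
  have h := ((Real.tendsto_exp_atBot.const_mul x).div
    ((Real.tendsto_exp_atBot.const_mul x).const_add (1 - x)) h1)
  rw [mul_zero, zero_div] at h
  exact h

theorem tendsto_one_sub_posteriorOfLLR_atTop {x : ℝ} (hx : x ∈ Ioo (0 : ℝ) 1) :
    Tendsto (fun L => 1 - posteriorOfLLR x L) atTop (𝓝 0) := by
  simp_rw [one_sub_posteriorOfLLR hx]
  exact (tendsto_atTop_add_const_left _ _
    (Real.tendsto_exp_atTop.const_mul_atTop hx.1)).const_div_atTop _

/-! ### The continuation region is a bounded open interval -/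

namespace SensorTestProblem

variable {K : ℕ} {X : Type*} [MeasurableSpace X] (M : SensorTestProblem K X)

/-- The log-likelihood ratios at which one more sample is better than stopping. -/
def continueSet (x : ℝ) : Set ℝ :=
  {L | M.continueCost M.optCost (posteriorOfLLR x L) < M.stopCost (posteriorOfLLR x L)}

theorem continueCost_lt_left_of_mem {x L : ℝ} (hL : L ∈ M.continueSet x) :
    M.continueCost M.optCost (posteriorOfLLR x L) < M.μ₁ * posteriorOfLLR x L :=
  (lt_min_iff.1 hL).1

theorem continueCost_lt_right_of_mem {x L : ℝ} (hL : L ∈ M.continueSet x) :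
    M.continueCost M.optCost (posteriorOfLLR x L) < M.μ₀ * (1 - posteriorOfLLR x L) :=
  (lt_min_iff.1 hL).2

theorem mem_continueSet_of_le [NeZero K] {x : ℝ} (hx : x ∈ Ioo (0 : ℝ) 1) {L L' : ℝ} (h : L ≤ L')
    (hL : L ∈ M.continueSet x)
    (hd : M.μ₁ * posteriorOfLLR x L' ≤ M.μ₀ * (1 - posteriorOfLLR x L')) :
    L' ∈ M.continueSet x := by
  change _ < M.stopCost _
  rw [stopCost, min_eq_left hd]
  refine M.concaveOn_continueCost_optCost.lt_mul_of_le ?_ (posteriorOfLLR_mem_Ioo hx L).1.le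
    (monotone_posteriorOfLLR hx h) (posteriorOfLLR_mem_Ioo hx L').2.le
    (M.continueCost_lt_left_of_mem hL)
  linarith [M.one_le_continueCost_optCost (x := 0) (by simp)]

theorem mem_continueSet_of_ge [NeZero K] {x : ℝ} (hx : x ∈ Ioo (0 : ℝ) 1) {L L' : ℝ} (h : L' ≤ L)
    (hL : L ∈ M.continueSet x)
    (hd : M.μ₀ * (1 - posteriorOfLLR x L') ≤ M.μ₁ * posteriorOfLLR x L') :
    L' ∈ M.continueSet x := by
  change _ < M.stopCost _
  rw [stopCost, min_eq_right hd]
  refine M.concaveOn_continueCost_optCost.lt_mul_one_sub_of_le ?_ (posteriorOfLLR_mem_Ioo hx L).2.le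
    (monotone_posteriorOfLLR hx h) (posteriorOfLLR_mem_Ioo hx L').1.le
    (M.continueCost_lt_right_of_mem hL)
  linarith [M.one_le_continueCost_optCost (x := 1) (by simp)]

/-- At an intermediate point `φ` equals one of its two lines. For the line through 0 the left
endpoint propagates to the right, for the line vanishing at 1 the right endpoint propagates to the
left. -/
theorem ordConnected_continueSet [NeZero K] {x : ℝ} (hx : x ∈ Ioo (0 : ℝ) 1) :
    (M.continueSet x).OrdConnected := by
  refine ⟨fun L hL L' hL' z hz => ?_⟩
  rcases le_total (M.μ₁ * posteriorOfLLR x z) (M.μ₀ * (1 - posteriorOfLLR x z)) with h | h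
  · exact M.mem_continueSet_of_le hx hz.1 hL h
  · exact M.mem_continueSet_of_ge hx hz.2 hL' h

/-- A concave function is continuous in the interior of its domain, where the posterior stays for
finite `L` and a nondegenerate prior. -/
theorem isOpen_continueSet [NeZero K] {x : ℝ} (hx : x ∈ Ioo (0 : ℝ) 1) :
    IsOpen (M.continueSet x) := by
  have h := M.concaveOn_continueCost_optCost.continuousOn_interior
  rw [interior_Icc] at h
  have hc := h.comp_continuous (continuous_posteriorOfLLR hx) (posteriorOfLLR_mem_Ioo hx)
  have hs : Continuous M.stopCost := by
    unfold stopCost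
    fun_prop
  exact isOpen_lt hc (hs.comp (continuous_posteriorOfLLR hx))

/-- Continuing costs at least 1, while the loss of accepting `H_0` tends to 0 as `L → -∞`. -/
theorem bddBelow_continueSet [NeZero K] {x : ℝ} (hx : x ∈ Ioo (0 : ℝ) 1) :
    BddBelow (M.continueSet x) := by
  have h : Tendsto (fun L => (M.μ₁ : ℝ) * posteriorOfLLR x L) atBot (𝓝 (M.μ₁ * 0)) :=
    (tendsto_posteriorOfLLR_atBot hx).const_mul _
  rw [mul_zero] at h
  obtain ⟨a, ha⟩ := eventually_atBot.1 (h.eventually_lt_const zero_lt_one)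
  refine ⟨a, fun L hL => ?_⟩
  by_contra! hlt
  have h1 := ha L hlt.le
  have h2 := M.one_le_continueCost_optCost
    (Ioo_subset_Icc_self (posteriorOfLLR_mem_Ioo hx L))
  have h3 := M.continueCost_lt_left_of_mem hL
  linarith

theorem bddAbove_continueSet [NeZero K] {x : ℝ} (hx : x ∈ Ioo (0 : ℝ) 1) :
    BddAbove (M.continueSet x) := by
  have h : Tendsto (fun L => (M.μ₀ : ℝ) * (1 - posteriorOfLLR x L)) atTop (𝓝 (M.μ₀ * 0)) :=
    (tendsto_one_sub_posteriorOfLLR_atTop hx).const_mul _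
  rw [mul_zero] at h
  obtain ⟨a, ha⟩ := eventually_atTop.1 (h.eventually_lt_const zero_lt_one)
  refine ⟨a, fun L hL => ?_⟩
  by_contra! hlt
  have h1 := ha L hlt.le
  have h2 := M.one_le_continueCost_optCost
    (Ioo_subset_Icc_self (posteriorOfLLR_mem_Ioo hx L))
  have h3 := M.continueCost_lt_right_of_mem hL
  linarith

theorem continueSet_eq_Ioo [NeZero K] {x : ℝ} (hx : x ∈ Ioo (0 : ℝ) 1)
    (hne : (M.continueSet x).Nonempty) :
    M.continueSet x = Ioo (sInf (M.continueSet x)) (sSup (M.continueSet x)) := by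
  have hb := M.bddBelow_continueSet hx
  have ha := M.bddAbove_continueSet hx
  refine Subset.antisymm ?_ ?_
  · rw [← interior_Icc]
    exact interior_maximal (subset_Icc_csInf_csSup hb ha) (M.isOpen_continueSet hx)
  · exact IsConnected.Ioo_csInf_csSup_subset
      ⟨hne, (M.ordConnected_continueSet hx).isPreconnected⟩ hb ha

/-- At the priors 0 and 1 the posterior never moves and the correct decision is free. -/
theorem continueSet_eq_empty_of_notMem_Ioo [NeZero K] {x : ℝ} (hx : x ∈ Icc (0 : ℝ) 1)
    (h : x ∉ Ioo (0 : ℝ) 1) : M.continueSet x = ∅ := by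
  refine eq_empty_of_forall_notMem fun L hL => ?_
  have h1 := M.one_le_continueCost_optCost (posteriorOfLLR_mem_Icc hx L)
  have h2 := M.continueCost_lt_left_of_mem hL
  have h3 := M.continueCost_lt_right_of_mem hL
  have h4 : x = 0 ∨ x = 1 := by
    by_contra! h4
    exact h ⟨lt_of_le_of_ne hx.1 h4.1.symm, lt_of_le_of_ne hx.2 h4.2⟩
  rcases h4 with rfl | rfl
  · have : posteriorOfLLR 0 L = 0 := by simp [posteriorOfLLR]
    rw [this] at h1 h2
    linarith
  · have : posteriorOfLLR 1 L = 1 := by simp [posteriorOfLLR]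
    rw [this] at h1 h3
    linarith

end SensorTestProblem

/-! ### Extended log-likelihood ratios and the SPRT as a procedure -/

/-- The posterior probability of `H_1` as a function of the extended log-likelihood ratio. -/
noncomputable def posteriorOfEReal (x : ℝ) (L : EReal) : ℝ :=
  if L = ⊥ then 0 else if L = ⊤ then 1 else posteriorOfLLR x L.toReal

@[simp]
theorem posteriorOfEReal_coe (x L : ℝ) : posteriorOfEReal x (L : EReal) = posteriorOfLLR x L := by
  simp [posteriorOfEReal]

@[simp]
theorem posteriorOfEReal_bot (x : ℝ) : posteriorOfEReal x ⊥ = 0 := by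
  simp [posteriorOfEReal]

@[simp]
theorem posteriorOfEReal_top (x : ℝ) : posteriorOfEReal x ⊤ = 1 := by
  simp [posteriorOfEReal]

namespace SensorTestProblem

variable {K : ℕ} {X : Type*} [MeasurableSpace X] (M : SensorTestProblem K X)

theorem measurable_llr (ℓ : Fin K) : Measurable (M.llr ℓ) :=
  ((M.measurable_density 1 ℓ).coe_nnreal_ennreal.div
    (M.measurable_density 0 ℓ).coe_nnreal_ennreal).ennreal_log

/-- Bayes' rule multiplies the odds by the likelihood ratio. The default values agree too: if both
densities vanish, then `llr` is `⊥`, matching the updated posterior 0. -/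
theorem update_posteriorOfLLR {x : ℝ} (hx : x ∈ Ioo (0 : ℝ) 1) (L : ℝ) (ℓ : Fin K) (y : X) :
    M.update ℓ (posteriorOfLLR x L) y = posteriorOfEReal x (L + M.llr ℓ y) := by
  have hz := posteriorOfLLR_mem_Ioo hx L
  rw [update, llr]
  rcases eq_or_ne (M.density 1 ℓ y) 0 with h1 | h1
  · simp [h1]
  rcases eq_or_ne (M.density 0 ℓ y) 0 with h0 | h0
  · have h1' : (M.density 1 ℓ y : ℝ≥0∞) ≠ 0 := by simpa using h1
    have h1'' : (M.density 1 ℓ y : ℝ) ≠ 0 := by simpa using h1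
    rw [h0, ENNReal.coe_zero, ENNReal.div_zero h1', ENNReal.log_top, EReal.coe_add_top,
      posteriorOfEReal_top]
    simp only [NNReal.coe_zero, mul_zero, zero_add]
    exact div_self (mul_ne_zero hz.1.ne' h1'')
  · have p1 : (0 : ℝ) < M.density 1 ℓ y := NNReal.coe_pos.2 (pos_iff_ne_zero.2 h1)
    have p0 : (0 : ℝ) < M.density 0 ℓ y := NNReal.coe_pos.2 (pos_iff_ne_zero.2 h0)
    rw [← ENNReal.coe_div h0, ENNReal.log_of_nnreal (div_ne_zero h1 h0), ← EReal.coe_add,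
      posteriorOfEReal_coe, one_sub_posteriorOfLLR hx, posteriorOfLLR, posteriorOfLLR,
      Real.exp_add, NNReal.coe_div, Real.exp_log (div_pos p1 p0)]
    have e : 0 < Real.exp L := Real.exp_pos L
    have hx0 := hx.1
    have hx1 : 0 < 1 - x := sub_pos.2 hx.2
    have hd : 0 < 1 - x + x * Real.exp L := by positivity
    field_simp

open Classical in
/-- The sequential probability ratio test with thresholds `-A` and `B` and sensor selection `ψ`. -/
noncomputable def sprt (A B : ℝ) {ψ : EReal → Fin K} (hψ : Measurable ψ) :
    SequentialProcedure K X :=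
  SequentialProcedure.feedback (0 : EReal) (fun ℓ L y => L + M.llr ℓ y) ψ
    (Ioo ((-A : ℝ) : EReal) (B : EReal))ᶜ (fun L => if L ≤ ((-A : ℝ) : EReal) then 0 else 1)
    (fun ℓ => measurable_fst.add ((M.measurable_llr ℓ).comp measurable_snd)) hψ
    measurableSet_Ioo.compl
    (Measurable.ite (measurableSet_le measurable_id measurable_const) measurable_const
      measurable_const)

/-- The log-likelihood ratio of a history, if the sensors are selected by `ψ`. -/
noncomputable def historyLLR (ψ : EReal → Fin K) (n : ℕ) (h : Fin n → X) : EReal :=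
  SequentialProcedure.feedbackState (0 : EReal) (fun ℓ L y => L + M.llr ℓ y) ψ n h

theorem historyLLR_succ (ψ : EReal → Fin K) (n : ℕ) (h : Fin (n + 1) → X) :
    M.historyLLR ψ (n + 1) h = M.historyLLR ψ n (Fin.init h) +
      M.llr (ψ (M.historyLLR ψ n (Fin.init h))) (h (Fin.last n)) := rfl

section

variable (A B : ℝ) {ψ : EReal → Fin K} (hψ : Measurable ψ)

theorem select_sprt (n : ℕ) (h : Fin n → X) :
    (M.sprt A B hψ).select n h = ψ (M.historyLLR ψ n h) := rfl

theorem mem_stopSet_sprt {n : ℕ} {h : Fin n → X} : h ∈ (M.sprt A B hψ).stopSet n ↔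
    M.historyLLR ψ n h ∉ Ioo ((-A : ℝ) : EReal) (B : EReal) := Iff.rfl

open Classical in
theorem decide_sprt (n : ℕ) (h : Fin n → X) : (M.sprt A B hψ).decide n h =
    if M.historyLLR ψ n h ≤ ((-A : ℝ) : EReal) then 0 else 1 := rfl

theorem cumLLR_sprt (ω : ℕ → Fin K → X) (n : ℕ) : (M.sprt A B hψ).cumLLR M ω n =
    M.historyLLR ψ n ((M.sprt A B hψ).history ω n) := by
  induction n with
  | zero => simp [SequentialProcedure.cumLLR, historyLLR, SequentialProcedure.feedbackState]
  | succ n ih =>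
    have h : (M.sprt A B hψ).cumLLR M ω (n + 1) = (M.sprt A B hψ).cumLLR M ω n +
        M.llr ((M.sprt A B hψ).sensor ω n) ((M.sprt A B hψ).sample ω n) :=
      Finset.sum_range_succ _ _
    rw [h, ih, historyLLR_succ, SequentialProcedure.init_history]
    congr 2
    rw [SequentialProcedure.history, Fin.snoc_last]
    rfl

/-- For `-A = B` the test stops at time 0 with `L = 0`, so the two decision rules conflict only if
the common threshold is 0, which the hypothesis excludes. -/
theorem isStationarySPRT_sprt (h : -A < B ∨ -A = B ∧ B ≠ 0) :
    (M.sprt A B hψ).IsStationarySPRT M A B ψ where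
  sensor_eq ω t := by
    rw [cumLLR_sprt]
    rfl
  stopTime_eq ω := by
    simp only [cumLLR_sprt]
    rfl
  decide_zero ω n _ hn := by
    rw [cumLLR_sprt] at hn
    rw [decide_sprt, if_pos hn]
  decide_one ω n hT hn := by
    rw [cumLLR_sprt] at hn
    rw [decide_sprt, if_neg]
    intro hle
    have hBA : B ≤ -A := EReal.coe_le_coe_iff.1 (hn.trans hle)
    rcases h with h | ⟨h, hB⟩
    · linarith
    · have h0 : (M.sprt A B hψ).stopTime ω ≤ (0 : ℕ) := by
        refine iInf₂_le 0 ?_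
        rw [mem_stopSet_sprt, h, Ioo_self]
        exact notMem_empty _
      rw [hT, Nat.cast_le, Nat.le_zero] at h0
      subst h0
      have hz : M.historyLLR ψ 0 ((M.sprt A B hψ).history ω 0) = 0 := rfl
      rw [hz] at hn hle
      have h1 : B ≤ 0 := by exact_mod_cast hn
      have h2 : 0 ≤ -A := by exact_mod_cast hle
      exact hB (le_antisymm h1 (h ▸ h2))

/-- While the test runs, `L` lies between real thresholds. An infinite value can only be the last
one, and a sum `⊤ + ⊥` never occurs along an alive history. -/
theorem posterior_sprt {x : ℝ} (hx : x ∈ Ioo (0 : ℝ) 1) (n : ℕ) (h : Fin n → X)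
    (hh : h ∈ (M.sprt A B hψ).alive n) :
    (M.sprt A B hψ).posterior M x n h = posteriorOfEReal x (M.historyLLR ψ n h) := by
  induction n with
  | zero =>
    have h0 : M.historyLLR ψ 0 h = ((0 : ℝ) : EReal) := rfl
    rw [h0, posteriorOfEReal_coe, posteriorOfLLR_zero]
    rfl
  | succ n ih =>
    have hi := ih (Fin.init h) hh.1
    have hm := not_not.1 ((not_congr (M.mem_stopSet_sprt A B hψ)).1 hh.2)
    rw [historyLLR_succ, SequentialProcedure.posterior, select_sprt, hi]
    have ht : M.historyLLR ψ n (Fin.init h) ≠ ⊤ := (hm.2.trans (EReal.coe_lt_top B)).ne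
    have hb : M.historyLLR ψ n (Fin.init h) ≠ ⊥ := ((EReal.bot_lt_coe (-A)).trans hm.1).ne'
    rw [← EReal.coe_toReal ht hb, posteriorOfEReal_coe]
    exact M.update_posteriorOfLLR hx _ _ _

end

/-! ### Optimality of the SPRT -/

theorem optCost_eq_stopCost [NeZero K] {x : ℝ} (hx : x ∈ Icc (0 : ℝ) 1) {L : ℝ}
    (h : L ∉ M.continueSet x) :
    M.valueLimit (posteriorOfLLR x L) = ENNReal.ofReal (M.stopCost (posteriorOfLLR x L)) := by
  have hz := posteriorOfLLR_mem_Icc hx L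
  rw [← M.ofReal_optCost hz, M.solvesBellman_optCost _ hz, min_eq_left (not_lt.1 h)]

theorem decisionCost_zero (z : ℝ) : M.decisionCost 0 z = ENNReal.ofReal (M.μ₁ * z) := by
  simp [decisionCost, ENNReal.ofReal_mul]

theorem decisionCost_one (z : ℝ) : M.decisionCost 1 z = ENNReal.ofReal (M.μ₀ * (1 - z)) := by
  simp [decisionCost, ENNReal.ofReal_mul]

theorem isOptimal_of_risk_le [NeZero K] {x : ℝ} (hx : x ∈ Icc (0 : ℝ) 1)
    {p : SequentialProcedure K X} (h : M.risk x p ≤ M.valueLimit x) : M.IsOptimal x p := fun q => by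
  rw [← M.iInf_risk_eq_valueLimit hx] at h
  exact h.trans (iInf_le _ q)

/-- Stopping at time 0 is optimal here, and `hA` makes the position of `L = 0` relative to the
common threshold select the cheaper decision. -/
theorem isOptimal_sprt_of_continueSet_eq_empty [NeZero K] {x : ℝ} (hx : x ∈ Icc (0 : ℝ) 1)
    (he : M.continueSet x = ∅) {A B : ℝ} (hAB : -A = B)
    (hA : 0 ≤ -A ↔ M.μ₁ * x ≤ M.μ₀ * (1 - x)) {ψ : EReal → Fin K} (hψ : Measurable ψ) :
    M.IsOptimal x (M.sprt A B hψ) := by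
  have hterminal : ∀ n (h : Fin n → X), h ∈ (M.sprt A B hψ).stopSet n := fun n h => by
    rw [mem_stopSet_sprt, hAB, Ioo_self]
    exact notMem_empty _
  refine M.isOptimal_of_risk_le hx (M.risk_le hx M.measurable_valueLimit _ ?_
    fun n h _ hs => absurd (hterminal n h) hs)
  intro n h ha _
  cases n with
  | succ n => exact absurd (hterminal n _) ha.2
  | zero =>
    have hp : (M.sprt A B hψ).posterior M x 0 h = x := rfl
    have h0 : M.historyLLR ψ 0 h = ((0 : ℝ) : EReal) := rfl
    have hV := M.optCost_eq_stopCost hx (L := 0) (by simp [he])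
    rw [posteriorOfLLR_zero] at hV
    rw [hp, hV, decide_sprt, h0, stopCost]
    simp only [EReal.coe_le_coe_iff]
    split_ifs with hc
    · rw [M.decisionCost_zero, min_eq_left (hA.1 hc)]
    · rw [M.decisionCost_one, min_eq_right (not_le.1 fun hle => hc (hA.2 hle)).le]

theorem isOptimal_sprt_of_continueSet_eq_Ioo [NeZero K] {x : ℝ} (hx : x ∈ Ioo (0 : ℝ) 1) {A B : ℝ}
    (hAB : -A < B) (hS : M.continueSet x = Ioo (-A) B) {ψ : EReal → Fin K} (hψ : Measurable ψ)
    (hmin : ∀ (L : ℝ) (ℓ : Fin K), M.sensorCost M.optCost (posteriorOfLLR x L) (ψ L) ≤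
      M.sensorCost M.optCost (posteriorOfLLR x L) ℓ) :
    M.IsOptimal x (M.sprt A B hψ) := by
  have hx' := Ioo_subset_Icc_self hx
  obtain ⟨L₀, hL₀⟩ : (Ioo (-A) B).Nonempty := nonempty_Ioo.2 hAB
  refine M.isOptimal_of_risk_le hx' (M.risk_le hx' M.measurable_valueLimit _ ?_ ?_)
  · intro n h ha hs
    rw [mem_stopSet_sprt] at hs
    rw [M.posterior_sprt A B hψ hx n h ha, decide_sprt]
    -- At `⊥` and `⊤` the posterior is 0 or 1 and the accepted hypothesis has no loss.
    generalize M.historyLLR ψ n h = Λ at hs ⊢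
    induction Λ with
    | bot => simp [M.decisionCost_zero]
    | top => simp [M.decisionCost_one]
    | coe L =>
      have hL : L ∉ M.continueSet x := by
        rw [hS]
        exact fun hL => hs ⟨EReal.coe_lt_coe_iff.2 hL.1, EReal.coe_lt_coe_iff.2 hL.2⟩
      rw [posteriorOfEReal_coe, M.optCost_eq_stopCost hx' hL, stopCost]
      simp only [EReal.coe_le_coe_iff]
      split_ifs with hc
      -- Were `H_1` the better decision below `-A`, the continuation region would extend from `L₀`
      -- down to `L`.
      · rw [M.decisionCost_zero, min_eq_left]
        by_contra! hlt
        exact hL (M.mem_continueSet_of_ge hx (hc.trans hL₀.1.le) (hS ▸ hL₀) hlt.le)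
      · rw [M.decisionCost_one, min_eq_right]
        by_contra! hlt
        -- Symmetrically above `B`. Here only `-A < L` is known from the decision rule; `L < L₀`
        -- would place `L` inside the region.
        refine hL (M.mem_continueSet_of_le hx (L := L₀) ?_ (hS ▸ hL₀) hlt.le)
        by_contra! hlt'
        exact hL (hS ▸ ⟨not_le.1 hc, hlt'.trans hL₀.2⟩)
  · intro n h ha hs
    have hm := not_not.1 ((not_congr (M.mem_stopSet_sprt A B hψ)).1 hs)
    rw [M.posterior_sprt A B hψ hx n h ha, select_sprt]
    induction hL : M.historyLLR ψ n h with
    | bot => simp [hL] at hm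
    | top => simp [hL] at hm
    | coe L =>
      rw [hL] at hm
      have hLS : L ∈ M.continueSet x := by
        rw [hS]
        exact ⟨EReal.coe_lt_coe_iff.1 hm.1, EReal.coe_lt_coe_iff.1 hm.2⟩
      have hz := posteriorOfLLR_mem_Icc hx' L
      have hc : M.sensorCost M.optCost (posteriorOfLLR x L) (ψ L) ≤
          M.continueCost M.optCost (posteriorOfLLR x L) := le_ciInf fun ℓ => hmin L ℓ
      rw [posteriorOfEReal_coe, ← M.ofReal_sensorCost_optCost hz, ← M.ofReal_optCost hz,
        M.solvesBellman_optCost _ hz, min_eq_right (le_of_lt hLS)]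
      exact ENNReal.ofReal_le_ofReal hc

/-- The selection is made through `EReal.toReal`; its values at infinite `L` are irrelevant, as the
test has then stopped. -/
theorem exists_measurable_argmin_sensorCost [NeZero K] {x : ℝ} (hx : x ∈ Icc (0 : ℝ) 1) :
    ∃ ψ : EReal → Fin K, Measurable ψ ∧ ∀ (L : ℝ) (ℓ : Fin K),
      M.sensorCost M.optCost (posteriorOfLLR x L) (ψ L) ≤
        M.sensorCost M.optCost (posteriorOfLLR x L) ℓ := by
  obtain ⟨ψ, hψ, hmin⟩ := exists_measurable_argmin fun ℓ : Fin K =>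
    (M.measurable_sensorCostENNReal M.measurable_valueLimit ℓ).comp
      ((measurable_posteriorOfLLR x).comp measurable_ereal_toReal)
  refine ⟨ψ, hψ, fun L ℓ => ?_⟩
  have hz := posteriorOfLLR_mem_Icc hx L
  have h := hmin L ℓ
  simp only [Function.comp_apply, EReal.toReal_coe] at h
  rw [← M.ofReal_sensorCost_optCost hz, ← M.ofReal_sensorCost_optCost hz] at h
  have hn : 0 ≤ M.sensorCost M.optCost (posteriorOfLLR x L) ℓ := by
    have h1 := M.one_le_continueCost_optCost hz
    have h2 : M.continueCost M.optCost (posteriorOfLLR x L) ≤ _ :=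
      ciInf_le (finite_range _).bddBelow ℓ
    linarith
  exact (ENNReal.ofReal_le_ofReal_iff hn).1 h

theorem exists_optimal_sprt [NeZero K] {x : ℝ} (hx : x ∈ Icc (0 : ℝ) 1) :
    ∃ (A B : ℝ) (ψ : EReal → Fin K) (p : SequentialProcedure K X),
      -A ≤ B ∧ Measurable ψ ∧ p.IsStationarySPRT M A B ψ ∧ M.IsOptimal x p ∧
      (∀ L : ℝ, L ∈ Ioo (-A) B ↔
        M.continueCost M.optCost (posteriorOfLLR x L) < M.stopCost (posteriorOfLLR x L)) ∧
      (∀ (L : ℝ) (ℓ : Fin K),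
        M.sensorCost M.optCost (posteriorOfLLR x L) (ψ L) ≤
          M.sensorCost M.optCost (posteriorOfLLR x L) ℓ) := by
  obtain ⟨ψ, hψ, hmin⟩ := M.exists_measurable_argmin_sensorCost hx
  rcases (M.continueSet x).eq_empty_or_nonempty with he | hne
  -- The sign of the common threshold encodes the decision at `L = 0`: `B = 1` accepts `H_0` and `B
  -- = -1` accepts `H_1`.
  · obtain ⟨B, hB0, hB⟩ : ∃ B : ℝ, B ≠ 0 ∧ (0 ≤ B ↔ M.μ₁ * x ≤ M.μ₀ * (1 - x)) := by
      by_cases h : M.μ₁ * x ≤ M.μ₀ * (1 - x)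
      · exact ⟨1, one_ne_zero, by simp [h]⟩
      · exact ⟨-1, by norm_num, by simp only [h, iff_false]; norm_num⟩
    have hAB : -(-B) = B := neg_neg B
    refine ⟨-B, B, ψ, M.sprt (-B) B hψ, hAB.le, hψ,
      M.isStationarySPRT_sprt _ _ hψ (Or.inr ⟨hAB, hB0⟩),
      M.isOptimal_sprt_of_continueSet_eq_empty hx he hAB (by rwa [hAB]) hψ, fun L => ?_, hmin⟩
    change _ ↔ L ∈ M.continueSet x
    rw [he, hAB, Ioo_self]
  · have hx' : x ∈ Ioo (0 : ℝ) 1 := by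
      by_contra h
      rw [M.continueSet_eq_empty_of_notMem_Ioo hx h] at hne
      exact not_nonempty_empty hne
    have hS := M.continueSet_eq_Ioo hx' hne
    rw [← neg_neg (sInf (M.continueSet x))] at hS
    generalize -sInf (M.continueSet x) = A at hS
    generalize sSup (M.continueSet x) = B at hS
    have hAB : -A < B := nonempty_Ioo.1 (hS ▸ hne)
    refine ⟨A, B, ψ, M.sprt A B hψ, hAB.le, hψ, M.isStationarySPRT_sprt _ _ hψ (Or.inl hAB),
      M.isOptimal_sprt_of_continueSet_eq_Ioo hx' hAB hS hψ hmin, fun L => ?_, hmin⟩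
    rw [← hS]
    rfl

end SensorTestProblem

theorem theorem2 {K : ℕ} {X : Type*} [MeasurableSpace X] (hK : 0 < K)
    (M : SensorTestProblem K X) :
    -- for every prior there is an optimal procedure that is an SPRT with constant thresholds and
    -- stationary sensor selection, both obtained from the Bellman equation
    (∀ x ∈ Icc (0 : ℝ) 1,
      ∃ (A B : ℝ) (ψ : EReal → Fin K) (p : SequentialProcedure K X),
        -A ≤ B ∧ Measurable ψ ∧ p.IsStationarySPRT M A B ψ ∧ M.IsOptimal x p ∧
        (∀ L : ℝ, L ∈ Ioo (-A) B ↔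
          M.continueCost M.optCost (posteriorOfLLR x L) < M.stopCost (posteriorOfLLR x L)) ∧
        (∀ (L : ℝ) (ℓ : Fin K),
          M.sensorCost M.optCost (posteriorOfLLR x L) (ψ L) ≤
            M.sensorCost M.optCost (posteriorOfLLR x L) ℓ)) ∧
    -- the finite-horizon optimal costs converge to the infinite-horizon optimal cost
    (∀ x ∈ Icc (0 : ℝ) 1,
      Tendsto (fun N : ℕ => M.finiteOptCost N x) atTop (𝓝 (M.optCost x))) ∧
    -- the infinite-horizon optimal cost is the only bounded solution of the Bellman equation,
    -- and it is concave
    M.SolvesBellman M.optCost ∧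
    (∀ W : ℝ → ℝ, Measurable W → (∃ c : ℝ, ∀ x ∈ Icc (0 : ℝ) 1, |W x| ≤ c) →
      M.SolvesBellman W → EqOn W M.optCost (Icc 0 1)) ∧
    ConcaveOn ℝ (Icc 0 1) M.optCost := by
  have : NeZero K := ⟨hK.ne'⟩
  exact ⟨fun x hx => M.exists_optimal_sprt hx, fun x hx => M.tendsto_finiteOptCost hx,
    M.solvesBellman_optCost, fun W hW ⟨_, hc⟩ h => h.eqOn_optCost hW hc, M.concaveOn_optCost⟩
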